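/- **Setting.** Let $M$ be a von Neumann algebra with a faithful normal tracial state $\tau$, generated by self-adjoint elements $X_1,\dots,X_n$ that are algebraically free (no nonzero non-commutative polynomial vanishes at $(X_1,\dots,X_n)$), so that $M=W^*(X_1,\dots,X_n)$. Let $L^2(M)$ be the completion of $M$ for the inner product given by $\tau(y^*x)$, let $M_0=\mathbb C\langle X_1,\dots,X_n\rangle\subset M\subset L^2(M)$, and identify $L^2(M^{op})$ with $L^2(M)$. For each $i$, let $\partial_i$ be the free difference quotient, i.e. the derivation $\partial_i:M_0\to M_0\otimes M_0$ with $\partial_i(X_j)=\delta_{ij}\,1\otimes1$ and $\partial_i(PQ)=(P\otimes 1)\,\partial_iQ+\partial_iP\,(1\otimes Q)$ (where $(a\otimes b)(c\otimes d)=ac\otimes bd$). It is viewed as an unbounded operator $L^2(M)\to L^2(M)\bar\otimes L^2(M^{op})$ with domain $M_0$, with adjoint $\partial_i^*$ and, when closable, closure $\bar\partial_i$. The von Neumann tensor product $M\bar\otimes M^{op}$, acting on $L^2(M)\bar\otimes L^2(M^{op})$ by $(a\otimes b)(x\otimes y)=ax\otimes yb$, is regarded as a subset of $L^2(M)\bar\otimes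 L^2(M^{op})$ through $T\mapsto T(1\otimes1)$. Assume the *Lipschitz conjugate variable condition*: every $\partial_i$ is closable; for every $i$ the vector $1\otimes1$ lies in the domain of $\partial_i^*$, so that the conjugate variable $\xi_i:=\partial_i^*(1\otimes1)\in L^2(M)$ exists; and for all $i,j$ one has $\xi_i\in\mathrm{Dom}(\bar\partial_j)$ and $\bar\partial_j\xi_i\in M\bar\otimes M^{op}$. **Proposition.** Under these assumptions: 1. $\xi_i\in M$ for all $i$. 2. For all $i$, the vectors $1\otimes\xi_i$ and $\xi_i\otimes1$ lie in the domain of $\partial_i^*$, and the second-order conjugate variable $$\xi_i^{(2)}:=\partial_i^*(1\otimes\xi_i)=\partial_i^*(\xi_i\otimes1)$$ lies in $M$. 3. For all $i,j=1,\dots,n$, the second-order difference quotient $(\partial_i\otimes\mathrm{id})\circ\partial_j: M_0\to L^2(M)\bar\otimes L^2(M)\bar\otimes L^2(M)$ is a densely defined and closable operator on $L^2(M)$. -/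

import Mathlib

open scoped TensorProduct InnerProductSpace

noncomputable section

namespace FreeProb

/-! ### Hilbert space tensor products -/

section HilbertTensor

variable {E E' F F' : Type*}
  [NormedAddCommGroup E] [InnerProductSpace ℂ E]
  [NormedAddCommGroup E'] [InnerProductSpace ℂ E']
  [NormedAddCommGroup F] [InnerProductSpace ℂ F]
  [NormedAddCommGroup F'] [InnerProductSpace ℂ F']

variable (E F) in
/-- The Hilbert space tensor product: the completion of the algebraic tensor product for the inner
product `⟪a ⊗ b, c ⊗ d⟫ = ⟪a, c⟫ * ⟪b, d⟫`. -/
def HilbertTensor : Type _ := UniformSpace.Completion (E ⊗[ℂ] F)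

instance : NormedAddCommGroup (HilbertTensor E F) :=
  inferInstanceAs (NormedAddCommGroup (UniformSpace.Completion (E ⊗[ℂ] F)))
instance : InnerProductSpace ℂ (HilbertTensor E F) :=
  inferInstanceAs (InnerProductSpace ℂ (UniformSpace.Completion (E ⊗[ℂ] F)))
instance : CompleteSpace (HilbertTensor E F) :=
  inferInstanceAs (CompleteSpace (UniformSpace.Completion (E ⊗[ℂ] F)))

variable (E F) in
/-- The isometric embedding of the algebraic tensor product. -/
def toHilbertTensor : E ⊗[ℂ] F →ₗᵢ[ℂ] HilbertTensor E F :=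
  UniformSpace.Completion.toComplₗᵢ (𝕜 := ℂ) (E := E ⊗[ℂ] F)

theorem denseRange_toHilbertTensor : DenseRange (toHilbertTensor E F) :=
  UniformSpace.Completion.denseRange_coe

/-- The simple tensor `a ⊗ b` in the Hilbert space tensor product. -/
def htmul (a : E) (b : F) : HilbertTensor E F := toHilbertTensor E F (a ⊗ₜ[ℂ] b)

theorem inner_htmul (a c : E) (b d : F) :
    ⟪htmul a b, htmul c d⟫_ℂ = ⟪a, c⟫_ℂ * ⟪b, d⟫_ℂ := by
  rw [htmul, htmul, LinearIsometry.inner_map_map, TensorProduct.inner_tmul]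

theorem exists_orthonormal_sum (z : E ⊗[ℂ] F) :
    ∃ (m : ℕ) (e : Fin m → E) (f : Fin m → F), Orthonormal ℂ f ∧
      z = ∑ k, e k ⊗ₜ[ℂ] f k := by
  obtain ⟨E₀, F₀, _, _, hz⟩ :=
    TensorProduct.exists_finite_submodule_of_setFinite {z} (Set.finite_singleton z)
  obtain ⟨y, rfl⟩ := Set.singleton_subset_iff.mp hz
  let b := stdOrthonormalBasis ℂ F₀
  have key : ∀ y : E₀ ⊗[ℂ] F₀, ∃ e : Fin (Module.finrank ℂ F₀) → E,
      TensorProduct.mapIncl E₀ F₀ y = ∑ k, e k ⊗ₜ[ℂ] ((b k : F₀) : F) := by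
    intro y
    induction y with
    | zero => exact ⟨0, by simp⟩
    | tmul u v =>
      refine ⟨fun k => ⟪b k, v⟫_ℂ • (u : E), ?_⟩
      have hv : (v : F) = ∑ k, ⟪b k, v⟫_ℂ • ((b k : F₀) : F) := by
        have h := congrArg (fun w : F₀ => (w : F)) (b.sum_repr' v)
        simpa using h.symm
      simp only [TensorProduct.mapIncl, TensorProduct.map_tmul, Submodule.subtype_apply]
      conv_lhs => rw [hv]
      rw [TensorProduct.tmul_sum]
      simp [TensorProduct.smul_tmul]
    | add y₁ y₂ h₁ h₂ =>
      obtain ⟨e₁, h₁⟩ := h₁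
      obtain ⟨e₂, h₂⟩ := h₂
      exact ⟨e₁ + e₂, by simp [h₁, h₂, TensorProduct.add_tmul, Finset.sum_add_distrib]⟩
  obtain ⟨e, he⟩ := key y
  exact ⟨_, e, fun k => ((b k : F₀) : F),
    b.orthonormal.comp_linearIsometry F₀.subtypeₗᵢ, he⟩

theorem norm_sq_sum_tmul {m : ℕ} (e : Fin m → E) {f : Fin m → F} (hf : Orthonormal ℂ f) :
    ‖∑ k, e k ⊗ₜ[ℂ] f k‖ ^ 2 = ∑ k, ‖e k‖ ^ 2 := by
  have h : ⟪∑ k, e k ⊗ₜ[ℂ] f k, ∑ k, e k ⊗ₜ[ℂ] f k⟫_ℂ = ∑ k, ⟪e k, e k⟫_ℂ := by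
    simp only [sum_inner, inner_sum, TensorProduct.inner_tmul]
    simp [orthonormal_iff_ite.mp hf]
  simp only [inner_self_eq_norm_sq_to_K] at h
  apply Complex.ofReal_injective
  push_cast
  exact (inner_self_eq_norm_sq_to_K (𝕜 := ℂ) (∑ k, e k ⊗ₜ[ℂ] f k : E ⊗[ℂ] F)).symm.trans h

theorem norm_rTensor_le (S : E →L[ℂ] E') (z : E ⊗[ℂ] F) :
    ‖(S : E →ₗ[ℂ] E').rTensor F z‖ ≤ ‖S‖ * ‖z‖ := by
  obtain ⟨m, e, f, hf, rfl⟩ := exists_orthonormal_sum z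
  rw [← sq_le_sq₀ (norm_nonneg _) (by positivity), mul_pow, norm_sq_sum_tmul e hf]
  simp only [map_sum, LinearMap.rTensor_tmul, ContinuousLinearMap.coe_coe]
  rw [norm_sq_sum_tmul (fun k => S (e k)) hf, Finset.mul_sum]
  refine Finset.sum_le_sum fun k _ => ?_
  rw [← mul_pow]
  gcongr
  exact S.le_opNorm _

theorem norm_lTensor_le (T : F →L[ℂ] F') (z : E ⊗[ℂ] F) :
    ‖(T : F →ₗ[ℂ] F').lTensor E z‖ ≤ ‖T‖ * ‖z‖ := by
  have h := norm_rTensor_le (F := E) T (TensorProduct.comm ℂ E F z)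
  rw [← TensorProduct.commIsometry_apply, LinearIsometryEquiv.norm_map] at h
  refine le_trans (le_of_eq ?_) h
  rw [← LinearIsometryEquiv.norm_map (TensorProduct.commIsometry ℂ E F')]
  congr 1
  clear h
  induction z with
  | zero => simp
  | tmul a b => simp
  | add a b ha hb => simp only [map_add, ha, hb]

/-- The tensor product `S ⊗ T` of two bounded operators, on the algebraic tensor product. -/
def algTensorMap (S : E →L[ℂ] E') (T : F →L[ℂ] F') : E ⊗[ℂ] F →L[ℂ] E' ⊗[ℂ] F' :=
  ((S : E →ₗ[ℂ] E').rTensor F').mkContinuous ‖S‖ (norm_rTensor_le S) ∘L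
    ((T : F →ₗ[ℂ] F').lTensor E).mkContinuous ‖T‖ (norm_lTensor_le T)

/-- The bounded operator `S ⊗ T` on the Hilbert space tensor product. -/
def htensorMap (S : E →L[ℂ] E') (T : F →L[ℂ] F') :
    HilbertTensor E F →L[ℂ] HilbertTensor E' F' :=
  (algTensorMap S T).completion

theorem htensorMap_htmul (S : E →L[ℂ] E') (T : F →L[ℂ] F') (a : E) (b : F) :
    htensorMap S T (htmul a b) = htmul (S a) (T b) := by
  change (algTensorMap S T).completion ((a ⊗ₜ[ℂ] b : E ⊗[ℂ] F) : UniformSpace.Completion _) = _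
  rw [ContinuousLinearMap.completion_apply_coe]
  rfl

end HilbertTensor

/-! ### Von Neumann algebras and their standard Hilbert space -/

section VonNeumann

variable {H : Type*} [NormedAddCommGroup H] [InnerProductSpace ℂ H] [CompleteSpace H]

/-- The von Neumann algebra `W*(S)` generated by a set `S` of bounded operators: the double
commutant of `S ∪ S*`. -/
def vonNeumannGenerated (S : Set (H →L[ℂ] H)) : VonNeumannAlgebra H where
  toStarSubalgebra :=
    StarSubalgebra.centralizer ℂ (StarSubalgebra.centralizer ℂ S : Set (H →L[ℂ] H))
  centralizer_centralizer' := by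
    change Set.centralizer (Set.centralizer (Set.centralizer _)) = Set.centralizer _
    exact Set.centralizer_centralizer_centralizer _

theorem subset_vonNeumannGenerated (S : Set (H →L[ℂ] H)) :
    S ⊆ (vonNeumannGenerated S : Set (H →L[ℂ] H)) := by
  intro T hT c hc
  have key : ∀ d ∈ (StarSubalgebra.centralizer ℂ S : Set (H →L[ℂ] H)), d * T = T * d :=
    fun d hd => (hd T (Or.inl hT)).symm
  rcases hc with hc | hc
  · exact key c hc
  · have h : star c ∈ StarSubalgebra.centralizer ℂ S := hc
    exact key c (star_star c ▸ star_mem h)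

/-- A faithful normal tracial state on a von Neumann algebra. Normality is expressed in the usual
form of a σ-weakly continuous positive functional `x ↦ ∑ₖ ⟪hₖ, x hₖ⟫` with `∑ₖ ‖hₖ‖² < ∞`. -/
structure TracialState (M : VonNeumannAlgebra H) where
  toLinearMap : M.toStarSubalgebra →ₗ[ℂ] ℂ
  map_one : toLinearMap 1 = 1
  tracial : ∀ x y, toLinearMap (x * y) = toLinearMap (y * x)
  faithful : ∀ x, toLinearMap (star x * x) = 0 → x = 0
  normal : ∃ h : ℕ → H, Summable (fun k => ‖h k‖ ^ 2) ∧
    ∀ x : M.toStarSubalgebra,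
      HasSum (fun k => ⟪h k, (x : H →L[ℂ] H) (h k)⟫_ℂ) (toLinearMap x)

namespace TracialState

variable {M : VonNeumannAlgebra H} (τ : TracialState M)

instance : CoeFun (TracialState M) (fun _ => M.toStarSubalgebra → ℂ) := ⟨fun τ => τ.toLinearMap⟩

theorem exists_hasSum_mul : ∃ h : ℕ → H, ∀ x y : M.toStarSubalgebra,
    HasSum (fun k => ⟪(x : H →L[ℂ] H) (h k), (y : H →L[ℂ] H) (h k)⟫_ℂ) (τ (star x * y)) := by
  obtain ⟨h, -, hh⟩ := τ.normal
  refine ⟨h, fun x y => ?_⟩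
  convert hh (star x * y) using 2 with k
  simp [ContinuousLinearMap.star_eq_adjoint, ContinuousLinearMap.adjoint_inner_right]

theorem exists_hasSum_norm : ∃ h : ℕ → H, ∀ x : M.toStarSubalgebra,
    HasSum (fun k => ‖(x : H →L[ℂ] H) (h k)‖ ^ 2) (τ (star x * x)).re := by
  obtain ⟨h, hh⟩ := τ.exists_hasSum_mul
  refine ⟨h, fun x => ?_⟩
  have := Complex.hasSum_re (hh x x)
  convert this using 2 with k
  exact (inner_self_eq_norm_sq (𝕜 := ℂ) ((x : H →L[ℂ] H) (h k))).symm

/-- The algebra `M`, as a pre-Hilbert space for the inner product `⟪x, y⟫ = τ(x* y)`. -/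
def PreL2 (_τ : TracialState M) : Type _ := M.toStarSubalgebra

instance : AddCommGroup τ.PreL2 := inferInstanceAs (AddCommGroup M.toStarSubalgebra)
instance : Module ℂ τ.PreL2 := inferInstanceAs (Module ℂ M.toStarSubalgebra)

/-- The identity map from `M` to the pre-Hilbert space. -/
def toPreL2 : M.toStarSubalgebra ≃ₗ[ℂ] τ.PreL2 := LinearEquiv.refl ℂ _

/-- The inner product `⟪x, y⟫ = τ(x* y)`. -/
@[reducible] def preL2Core : InnerProductSpace.Core ℂ τ.PreL2 where
  inner x y := τ (star (τ.toPreL2.symm x) * τ.toPreL2.symm y)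
  conj_inner_symm x y := by
    obtain ⟨h, hh⟩ := τ.exists_hasSum_mul
    have h₁ := (hh (τ.toPreL2.symm y) (τ.toPreL2.symm x)).star
    simp only [Complex.star_def, inner_conj_symm] at h₁
    exact h₁.unique (hh (τ.toPreL2.symm x) (τ.toPreL2.symm y))
  re_inner_nonneg x := by
    obtain ⟨h, hh⟩ := τ.exists_hasSum_norm
    exact (hh (τ.toPreL2.symm x)).nonneg fun k => by positivity
  add_left x y z := by simp [add_mul]
  smul_left x y r := by simp
  definite x hx := by
    have := τ.faithful (τ.toPreL2.symm x) hx
    simpa using this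

instance : NormedAddCommGroup τ.PreL2 := τ.preL2Core.toNormedAddCommGroup
instance : InnerProductSpace ℂ τ.PreL2 := InnerProductSpace.ofCore τ.preL2Core.toCore

theorem preL2_inner (x y : M.toStarSubalgebra) :
    ⟪τ.toPreL2 x, τ.toPreL2 y⟫_ℂ = τ (star x * y) := rfl

theorem preL2_norm_sq (x : M.toStarSubalgebra) :
    ‖τ.toPreL2 x‖ ^ 2 = (τ (star x * x)).re := by
  rw [← preL2_inner]
  exact (inner_self_eq_norm_sq (𝕜 := ℂ) _).symm

theorem preL2_norm_star (x : M.toStarSubalgebra) :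
    ‖τ.toPreL2 (star x)‖ = ‖τ.toPreL2 x‖ := by
  rw [← sq_eq_sq₀ (norm_nonneg _) (norm_nonneg _), preL2_norm_sq, preL2_norm_sq, star_star,
    τ.tracial]

theorem preL2_norm_mul_le (a x : M.toStarSubalgebra) :
    ‖τ.toPreL2 (a * x)‖ ≤ ‖(a : H →L[ℂ] H)‖ * ‖τ.toPreL2 x‖ := by
  obtain ⟨h, hh⟩ := τ.exists_hasSum_norm
  rw [← sq_le_sq₀ (norm_nonneg _) (by positivity), mul_pow, preL2_norm_sq, preL2_norm_sq]
  refine hasSum_le (fun k => ?_) (hh (a * x)) ((hh x).mul_left _)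
  rw [← mul_pow]
  gcongr
  exact (a : H →L[ℂ] H).le_opNorm _

theorem preL2_norm_mul_le' (b x : M.toStarSubalgebra) :
    ‖τ.toPreL2 (x * b)‖ ≤ ‖(b : H →L[ℂ] H)‖ * ‖τ.toPreL2 x‖ := by
  rw [← preL2_norm_star, star_mul]
  refine (τ.preL2_norm_mul_le (star b) (star x)).trans (le_of_eq ?_)
  rw [preL2_norm_star]
  congr 1
  exact norm_star (b : H →L[ℂ] H)

/-- The Hilbert space `L²(M, τ)`. -/
def L2 : Type _ := UniformSpace.Completion τ.PreL2

instance : NormedAddCommGroup τ.L2 :=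
  inferInstanceAs (NormedAddCommGroup (UniformSpace.Completion τ.PreL2))
instance : InnerProductSpace ℂ τ.L2 :=
  inferInstanceAs (InnerProductSpace ℂ (UniformSpace.Completion τ.PreL2))
instance : CompleteSpace τ.L2 :=
  inferInstanceAs (CompleteSpace (UniformSpace.Completion τ.PreL2))

/-- The canonical embedding `M ⊆ L²(M, τ)`. -/
def toL2 : M.toStarSubalgebra →ₗ[ℂ] τ.L2 :=
  (UniformSpace.Completion.toComplₗᵢ (𝕜 := ℂ) (E := τ.PreL2)).toLinearMap ∘ₗ τ.toPreL2.toLinearMap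

theorem denseRange_toL2 : DenseRange τ.toL2 :=
  UniformSpace.Completion.denseRange_coe.comp τ.toPreL2.surjective.denseRange
    (UniformSpace.Completion.continuous_coe _)

theorem toL2_injective : Function.Injective τ.toL2 := by
  intro x y hxy
  exact τ.toPreL2.injective (UniformSpace.Completion.coe_injective _ hxy)

theorem inner_toL2 (x y : M.toStarSubalgebra) : ⟪τ.toL2 x, τ.toL2 y⟫_ℂ = τ (star x * y) := by
  change ⟪((τ.toPreL2 x : τ.PreL2) : UniformSpace.Completion τ.PreL2),
    ((τ.toPreL2 y : τ.PreL2) : UniformSpace.Completion τ.PreL2)⟫_ℂ = _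
  rw [UniformSpace.Completion.inner_coe, preL2_inner]

/-- Left multiplication by `a ∈ M` on `L²(M, τ)`. -/
def leftMul (a : M.toStarSubalgebra) : τ.L2 →L[ℂ] τ.L2 :=
  ((τ.toPreL2.toLinearMap ∘ₗ LinearMap.mulLeft ℂ a ∘ₗ τ.toPreL2.symm.toLinearMap).mkContinuous
    ‖(a : H →L[ℂ] H)‖ fun x => τ.preL2_norm_mul_le a (τ.toPreL2.symm x)).completion

/-- Right multiplication by `b ∈ M` on `L²(M, τ)`, that is, the left action of `b ∈ Mᵒᵖ`. -/
def rightMul (b : M.toStarSubalgebra) : τ.L2 →L[ℂ] τ.L2 :=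
  ((τ.toPreL2.toLinearMap ∘ₗ LinearMap.mulRight ℂ b ∘ₗ τ.toPreL2.symm.toLinearMap).mkContinuous
    ‖(b : H →L[ℂ] H)‖ fun x => τ.preL2_norm_mul_le' b (τ.toPreL2.symm x)).completion

theorem leftMul_toL2 (a x : M.toStarSubalgebra) : τ.leftMul a (τ.toL2 x) = τ.toL2 (a * x) := by
  change ((LinearMap.mkContinuous _ _ _ : τ.PreL2 →L[ℂ] τ.PreL2).completion
    ((τ.toPreL2 x : τ.PreL2) : UniformSpace.Completion τ.PreL2)) = _
  rw [ContinuousLinearMap.completion_apply_coe]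
  rfl

theorem rightMul_toL2 (b x : M.toStarSubalgebra) : τ.rightMul b (τ.toL2 x) = τ.toL2 (x * b) := by
  change ((LinearMap.mkContinuous _ _ _ : τ.PreL2 →L[ℂ] τ.PreL2).completion
    ((τ.toPreL2 x : τ.PreL2) : UniformSpace.Completion τ.PreL2)) = _
  rw [ContinuousLinearMap.completion_apply_coe]
  rfl

/-- The Hilbert space `L²(M) ⊗ L²(Mᵒᵖ)`, where `L²(Mᵒᵖ)` is identified with `L²(M)`. -/
abbrev L2L2 : Type _ := HilbertTensor τ.L2 τ.L2

/-- The Hilbert space `L²(M) ⊗ L²(M) ⊗ L²(M)`. -/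
abbrev L2L2L2 : Type _ := HilbertTensor τ.L2L2 τ.L2

/-- The vector `1 ⊗ 1`. -/
def oneOne : τ.L2L2 := htmul (τ.toL2 1) (τ.toL2 1)

/-- The von Neumann tensor product of `M` and `Mᵒᵖ`, acting on `L²(M) ⊗ L²(Mᵒᵖ)`: it is generated
by the operators `a ⊗ bᵒᵖ : x ⊗ y ↦ a x ⊗ y b`. -/
def tensorOp : VonNeumannAlgebra τ.L2L2 :=
  vonNeumannGenerated {T | ∃ a b, T = htensorMap (τ.leftMul a) (τ.rightMul b)}

/-- The image of `M` in `L²(M)`. -/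
def bounded : Set τ.L2 := Set.range τ.toL2

/-- The image of the von Neumann tensor product of `M` and `Mᵒᵖ` in `L²(M) ⊗ L²(Mᵒᵖ)`, under
`T ↦ T (1 ⊗ 1)`. -/
def boundedTensor : Set τ.L2L2 := {η | ∃ T ∈ τ.tensorOp, η = T τ.oneOne}

end TracialState

end VonNeumann

/-! ### Free difference quotients -/

section FreeDifferenceQuotient

variable {n : ℕ}

/-- The algebra homomorphism `P ↦ !![P ⊗ 1, ∂ᵢ P; 0, 1 ⊗ P]` on noncommutative polynomials. -/
def freeDiffHom (i : Fin n) : FreeAlgebra ℂ (Fin n) →ₐ[ℂ]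
    Matrix (Fin 2) (Fin 2) (FreeAlgebra ℂ (Fin n) ⊗[ℂ] FreeAlgebra ℂ (Fin n)) :=
  FreeAlgebra.lift ℂ fun j =>
    !![FreeAlgebra.ι ℂ j ⊗ₜ 1, if j = i then 1 else 0; 0, 1 ⊗ₜ FreeAlgebra.ι ℂ j]

/-- The free difference quotient `∂ᵢ` on noncommutative polynomials: the derivation with values in
the tensor square which maps the `j`-th variable to `δᵢⱼ 1 ⊗ 1`; see `freeDiff_ι` and
`freeDiff_mul`. -/
def freeDiff (i : Fin n) :
    FreeAlgebra ℂ (Fin n) →ₗ[ℂ] FreeAlgebra ℂ (Fin n) ⊗[ℂ] FreeAlgebra ℂ (Fin n) where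
  toFun P := freeDiffHom i P 0 1
  map_add' P Q := by simp
  map_smul' c P := by simp

theorem freeDiff_ι (i j : Fin n) :
    freeDiff i (FreeAlgebra.ι ℂ j) = if j = i then 1 ⊗ₜ 1 else 0 := by
  simp [freeDiff, freeDiffHom, Algebra.TensorProduct.one_def]

theorem freeDiffHom_apply (i : Fin n) (P : FreeAlgebra ℂ (Fin n)) :
    freeDiffHom i P = !![P ⊗ₜ 1, freeDiff i P; 0, 1 ⊗ₜ P] := by
  have h : freeDiffHom i P 0 0 = P ⊗ₜ 1 ∧ freeDiffHom i P 1 0 = 0 ∧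
      freeDiffHom i P 1 1 = 1 ⊗ₜ P := by
    induction P using FreeAlgebra.induction with
    | grade0 r =>
      simp only [AlgHom.commutes, Matrix.algebraMap_matrix_apply]
      simp [Algebra.algebraMap_eq_smul_one, TensorProduct.smul_tmul',
        Algebra.TensorProduct.one_def]
    | grade1 j => simp [freeDiffHom]
    | mul a b ha hb =>
      simp [Matrix.mul_apply, Fin.sum_univ_two, ha, hb]
    | add a b ha hb => simp [ha, hb, TensorProduct.add_tmul, TensorProduct.tmul_add]
  ext k l
  fin_cases k <;> fin_cases l <;> simp [h, freeDiff]

/-- The Leibniz rule `∂ᵢ(PQ) = (P ⊗ 1) ∂ᵢ Q + ∂ᵢ P (1 ⊗ Q)`. -/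
theorem freeDiff_mul (i : Fin n) (P Q : FreeAlgebra ℂ (Fin n)) :
    freeDiff i (P * Q) = (P ⊗ₜ 1) * freeDiff i Q + freeDiff i P * (1 ⊗ₜ Q) := by
  have h : freeDiff i (P * Q) = (freeDiffHom i P * freeDiffHom i Q) 0 1 := by
    rw [← map_mul]; rfl
  rw [h, freeDiffHom_apply, freeDiffHom_apply]
  simp [Matrix.mul_apply, Fin.sum_univ_two]

/-- The partially defined operator `f P ↦ g P`, for an injective linear map `f`. -/
def pmapOfInjective {A E F : Type*} [AddCommGroup A] [Module ℂ A] [AddCommGroup E] [Module ℂ E]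
    [AddCommGroup F] [Module ℂ F] (f : A →ₗ[ℂ] E) (hf : Function.Injective f) (g : A →ₗ[ℂ] F) :
    E →ₗ.[ℂ] F where
  domain := LinearMap.range f
  toFun := g ∘ₗ (LinearEquiv.ofInjective f hf).symm.toLinearMap

theorem pmapOfInjective_apply {A E F : Type*} [AddCommGroup A] [Module ℂ A] [AddCommGroup E]
    [Module ℂ E] [AddCommGroup F] [Module ℂ F] (f : A →ₗ[ℂ] E) (hf : Function.Injective f)
    (g : A →ₗ[ℂ] F) (P : A) :
    pmapOfInjective f hf g ⟨f P, LinearMap.mem_range_self f P⟩ = g P := by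
  exact congrArg g ((LinearEquiv.ofInjective f hf).symm_apply_apply P)

variable {H : Type*} [NormedAddCommGroup H] [InnerProductSpace ℂ H] [CompleteSpace H]
  {M : VonNeumannAlgebra H}

/-- The evaluation `P ↦ P(X₁, …, Xₙ)` of noncommutative polynomials. -/
def evalPoly (X : Fin n → M.toStarSubalgebra) :
    FreeAlgebra ℂ (Fin n) →ₐ[ℂ] M.toStarSubalgebra :=
  FreeAlgebra.lift ℂ X

/-- The tuple `X` is algebraically free: no nonzero noncommutative polynomial vanishes at it. -/
def AlgebraicallyFree (X : Fin n → M.toStarSubalgebra) : Prop :=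
  Function.Injective (evalPoly X)

variable (τ : TracialState M) (X : Fin n → M.toStarSubalgebra)

/-- The evaluation `P ↦ P(X₁, …, Xₙ) ∈ L²(M)`; its range is `M₀ = ℂ⟨X₁, …, Xₙ⟩`. -/
def evalL2 : FreeAlgebra ℂ (Fin n) →ₗ[ℂ] τ.L2 := τ.toL2 ∘ₗ (evalPoly X).toLinearMap

theorem evalL2_injective (hX : AlgebraicallyFree X) : Function.Injective (evalL2 τ X) :=
  τ.toL2_injective.comp hX

/-- The map `P ↦ (∂ᵢ P)(X₁, …, Xₙ) ∈ L²(M) ⊗ L²(Mᵒᵖ)`. -/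
def freeDiffL2 (i : Fin n) : FreeAlgebra ℂ (Fin n) →ₗ[ℂ] τ.L2L2 :=
  (toHilbertTensor τ.L2 τ.L2).toLinearMap ∘ₗ
    TensorProduct.map (evalL2 τ X) (evalL2 τ X) ∘ₗ freeDiff i

/-- The map `P ↦ ((∂ᵢ ⊗ id)(∂ⱼ P))(X₁, …, Xₙ) ∈ L²(M) ⊗ L²(M) ⊗ L²(M)`. -/
def freeDiff₂L2 (i j : Fin n) : FreeAlgebra ℂ (Fin n) →ₗ[ℂ] τ.L2L2L2 :=
  (toHilbertTensor τ.L2L2 τ.L2).toLinearMap ∘ₗ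
    TensorProduct.map (freeDiffL2 τ X i) (evalL2 τ X) ∘ₗ freeDiff j

variable {X} (hX : AlgebraicallyFree X)

/-- The partial free difference quotient `∂ᵢ`, as an unbounded operator from `L²(M)` to
`L²(M) ⊗ L²(Mᵒᵖ)` with domain `M₀ = ℂ⟨X₁, …, Xₙ⟩`. -/
def partialDiff (i : Fin n) : τ.L2 →ₗ.[ℂ] τ.L2L2 :=
  pmapOfInjective (evalL2 τ X) (evalL2_injective τ X hX) (freeDiffL2 τ X i)

/-- The second-order difference quotient `(∂ᵢ ⊗ id) ∘ ∂ⱼ`, as an unbounded operator from `L²(M)` to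
`L²(M) ⊗ L²(M) ⊗ L²(M)` with domain `M₀ = ℂ⟨X₁, …, Xₙ⟩`. -/
def partialDiff₂ (i j : Fin n) : τ.L2 →ₗ.[ℂ] τ.L2L2L2 :=
  pmapOfInjective (evalL2 τ X) (evalL2_injective τ X hX) (freeDiff₂L2 τ X i j)

/-- The conjugate variable `ξᵢ = ∂ᵢ*(1 ⊗ 1)`, when `1 ⊗ 1` is in the domain of `∂ᵢ*`. -/
def conjugateVariable (i : Fin n) (h : τ.oneOne ∈ (partialDiff τ hX i).adjoint.domain) : τ.L2 :=
  (partialDiff τ hX i).adjoint ⟨τ.oneOne, h⟩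

/-- The Lipschitz conjugate variable condition. -/
structure LipschitzConjugateVariables : Prop where
  closable : ∀ i, (partialDiff τ hX i).IsClosable
  exists_conjugate : ∀ i, τ.oneOne ∈ (partialDiff τ hX i).adjoint.domain
  lipschitz : ∀ i j, ∃ h : conjugateVariable τ hX i (exists_conjugate i) ∈
      (partialDiff τ hX j).closure.domain,
    (partialDiff τ hX j).closure ⟨conjugateVariable τ hX i (exists_conjugate i), h⟩ ∈
      τ.boundedTensor

end FreeDifferenceQuotient

end FreeProb

end

/-! Boundedness of `ξ i` rests on Voiculescu's identity P ⊗ 1 - 1 ⊗ P = ∑ⱼ ∂ⱼP # (Xⱼ ⊗ 1 - 1 ⊗ Xⱼ).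
It extends from polynomials to any η in the domain of every closure (`htmul_one_sub_one_htmul`),
because the adjoints are defined on polynomial tensors. If each ∂ⱼη is T_j(1 ⊗ 1) with T_j in the
von Neumann tensor product, the right side is Z(1 ⊗ 1) for a bounded Z commuting with right
multiplications on the first leg. Applying id ⊗ τ gives η - τ(η)1 = S1 with S bounded and commuting
with right multiplications, and the commutation theorem `apply_one_mem_bounded` puts S1 in M
(`mem_bounded_of_lipschitz`).

Once ξᵢ is bounded, ∂ᵢ*(η ⊗ 1) = η ξᵢ - (id ⊗ τ)(∂ᵢη) holds on the domain of the closure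
(`AdjointPair.htmul_one`). At η = ξᵢ both terms lie in M. Coassociativity of ∂ᵢ identifies the
result with ∂ᵢ*(1 ⊗ ξᵢ) (`AdjointPair.one_htmul`).

For the second-order quotient, the vectors P ⊗ Q ⊗ R are total and lie in the domain of its adjoint:
w = ∂ᵢ*(P ⊗ Q) stays in the domain of the closure of ∂ⱼ (`AdjointPair.exists_of_poly`), so the same
formula gives ∂ⱼ*(w ⊗ 1), and right multiplications then give ∂ⱼ*(w ⊗ R).

The operator-algebraic input uses normality of τ: the vectors hₖ representing τ give M-linear maps
Wₖ : x ↦ x hₖ from L²(M) to H that jointly separate points, which carries commutant arguments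
between H and L²(M). -/

namespace FreeProb

open ContinuousLinearMap

/-! ### Operators on Hilbert space tensor products -/

section HilbertTensor

variable {E E' F F' G : Type*}
  [NormedAddCommGroup E] [InnerProductSpace ℂ E]
  [NormedAddCommGroup E'] [InnerProductSpace ℂ E']
  [NormedAddCommGroup F] [InnerProductSpace ℂ F]
  [NormedAddCommGroup F'] [InnerProductSpace ℂ F']

/-- Two bounded operators on a Hilbert space tensor product agree if they do on simple tensors. -/
theorem ext_htmul [NormedAddCommGroup G] [InnerProductSpace ℂ G]
    {S T : HilbertTensor E F →L[ℂ] G} (h : ∀ a b, S (htmul a b) = T (htmul a b)) : S = T := by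
  refine ContinuousLinearMap.coeFn_injective
    (denseRange_toHilbertTensor.equalizer S.continuous T.continuous ?_)
  funext z
  induction z using TensorProduct.induction_on with
  | zero => simp
  | tmul a b => exact h a b
  | add x y hx hy => simpa using congrArg₂ (· + ·) hx hy

theorem ext_inner_htmul {u v : HilbertTensor E F}
    (h : ∀ a b, ⟪htmul a b, u⟫_ℂ = ⟪htmul a b, v⟫_ℂ) : u = v := by
  have key : innerSL ℂ u = innerSL ℂ v := ext_htmul fun a b => by
    simpa using congrArg (starRingEnd ℂ) (h a b)
  exact ext_inner_right ℂ fun w => by simpa using congrArg (fun T => T w) key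

theorem norm_htmul (a : E) (b : F) : ‖htmul a b‖ = ‖a‖ * ‖b‖ := by
  rw [htmul, LinearIsometry.norm_map, TensorProduct.norm_tmul]

variable (E) in
/-- The operator `x ↦ x ⊗ f`. -/
noncomputable def tmulRight (f : F) : E →L[ℂ] HilbertTensor E F :=
  ((toHilbertTensor E F).toLinearMap ∘ₗ (TensorProduct.mk ℂ E F).flip f).mkContinuous ‖f‖
    fun x => ((norm_htmul x f).trans (mul_comm _ _)).le

variable (F) in
/-- The operator `y ↦ e ⊗ y`. -/
noncomputable def tmulLeft (e : E) : F →L[ℂ] HilbertTensor E F :=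
  ((toHilbertTensor E F).toLinearMap ∘ₗ TensorProduct.mk ℂ E F e).mkContinuous ‖e‖
    fun y => (norm_htmul e y).le

@[simp] theorem tmulRight_apply (f : F) (x : E) : tmulRight E f x = htmul x f := rfl

@[simp] theorem tmulLeft_apply (e : E) (y : F) : tmulLeft F e y = htmul e y := rfl

@[simp] theorem htmul_add (a : E) (b c : F) : htmul a (b + c) = htmul a b + htmul a c :=
  map_add (tmulLeft F a) b c

@[simp] theorem add_htmul (a b : E) (c : F) : htmul (a + b) c = htmul a c + htmul b c :=
  map_add (tmulRight E c) a b

@[simp] theorem htmul_smul (r : ℂ) (a : E) (b : F) : htmul a (r • b) = r • htmul a b :=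
  map_smul (tmulLeft F a) r b

@[simp] theorem smul_htmul (r : ℂ) (a : E) (b : F) : htmul (r • a) b = r • htmul a b :=
  map_smul (tmulRight E b) r a

theorem tmulRight_adjoint_htmul [CompleteSpace E] (f b : F) (a : E) :
    adjoint (tmulRight E f) (htmul a b) = ⟪f, b⟫_ℂ • a := by
  refine ext_inner_left ℂ fun v => ?_
  rw [adjoint_inner_right, tmulRight_apply, inner_htmul, inner_smul_right, mul_comm]

theorem tmulLeft_adjoint_htmul [CompleteSpace F] (e a : E) (b : F) :
    adjoint (tmulLeft F e) (htmul a b) = ⟪e, a⟫_ℂ • b := by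
  refine ext_inner_left ℂ fun v => ?_
  rw [adjoint_inner_right, tmulLeft_apply, inner_htmul, inner_smul_right]

/-- If `f` and `g` have dense range, the vectors `f a ⊗ g b` are total. -/
theorem ext_inner_htmul_of_denseRange {A B : Type*} [CompleteSpace E] [CompleteSpace F]
    {f : A → E} {g : B → F} (hf : DenseRange f) (hg : DenseRange g) {u v : HilbertTensor E F}
    (h : ∀ a b, ⟪htmul (f a) (g b), u⟫_ℂ = ⟪htmul (f a) (g b), v⟫_ℂ) : u = v := by
  refine ext_inner_htmul fun x y => ?_
  have h₁ : ∀ b, ⟪htmul x (g b), u⟫_ℂ = ⟪htmul x (g b), v⟫_ℂ := fun b =>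
    hf.induction_on (p := fun x => ⟪tmulRight E (g b) x, u⟫_ℂ = ⟪tmulRight E (g b) x, v⟫_ℂ) x
      (isClosed_eq (by fun_prop) (by fun_prop)) fun a => h a b
  exact hg.induction_on (p := fun y => ⟪tmulLeft F x y, u⟫_ℂ = ⟪tmulLeft F x y, v⟫_ℂ) y
    (isClosed_eq (by fun_prop) (by fun_prop)) h₁

theorem htensorMap_adjoint [CompleteSpace E] [CompleteSpace E'] [CompleteSpace F]
    [CompleteSpace F'] (S : E →L[ℂ] E') (T : F →L[ℂ] F') :
    adjoint (htensorMap S T) = htensorMap (adjoint S) (adjoint T) := by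
  refine ext_htmul fun a b => ext_inner_htmul fun c d => ?_
  rw [adjoint_inner_right, htensorMap_htmul, htensorMap_htmul, inner_htmul, inner_htmul,
    adjoint_inner_right, adjoint_inner_right]

end HilbertTensor

/-! ### Left and right multiplications on `L²(M)` -/

namespace TracialState

variable {H : Type*} [NormedAddCommGroup H] [InnerProductSpace ℂ H] [CompleteSpace H]
  {M : VonNeumannAlgebra H} (τ : TracialState M)

theorem ext_toL2 {G : Type*} [NormedAddCommGroup G] [NormedSpace ℂ G]
    {S T : τ.L2 →L[ℂ] G} (h : ∀ x, S (τ.toL2 x) = T (τ.toL2 x)) : S = T :=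
  ContinuousLinearMap.coeFn_injective
    (τ.denseRange_toL2.equalizer S.continuous T.continuous (funext h))

theorem ext_inner_toL2 {u v : τ.L2} (h : ∀ x, ⟪τ.toL2 x, u⟫_ℂ = ⟪τ.toL2 x, v⟫_ℂ) : u = v := by
  refine τ.denseRange_toL2.eq_of_inner_left ℂ fun x => ?_
  rw [← inner_conj_symm, ← inner_conj_symm v, h]

theorem leftMul_rightMul (a b : M.toStarSubalgebra) (x : τ.L2) :
    τ.leftMul a (τ.rightMul b x) = τ.rightMul b (τ.leftMul a x) := by
  have : τ.leftMul a ∘L τ.rightMul b = τ.rightMul b ∘L τ.leftMul a :=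
    τ.ext_toL2 fun x => by simp [leftMul_toL2, rightMul_toL2, mul_assoc]
  exact congrArg (fun T => T x) this

theorem leftMul_adjoint (a : M.toStarSubalgebra) :
    adjoint (τ.leftMul a) = τ.leftMul (star a) :=
  τ.ext_toL2 fun x => τ.ext_inner_toL2 fun y => by
    rw [adjoint_inner_right, leftMul_toL2, leftMul_toL2, inner_toL2, inner_toL2, star_mul,
      mul_assoc]

theorem rightMul_adjoint (a : M.toStarSubalgebra) :
    adjoint (τ.rightMul a) = τ.rightMul (star a) :=
  τ.ext_toL2 fun x => τ.ext_inner_toL2 fun y => by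
    rw [adjoint_inner_right, rightMul_toL2, rightMul_toL2, inner_toL2, inner_toL2, star_mul,
      mul_assoc, τ.tracial, mul_assoc]

/-- The modular conjugation of `L²(M)`, extending `x ↦ x*`. -/
noncomputable def conj : τ.L2 → τ.L2 :=
  UniformSpace.Completion.map fun x : τ.PreL2 => τ.toPreL2 (star (τ.toPreL2.symm x))

theorem uniformContinuous_star :
    UniformContinuous fun x : τ.PreL2 => τ.toPreL2 (star (τ.toPreL2.symm x)) := by
  refine (AddMonoidHomClass.isometry_of_norm
    ({ toFun := fun x : τ.PreL2 => τ.toPreL2 (star (τ.toPreL2.symm x))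
       map_zero' := by simp
       map_add' := by simp } : τ.PreL2 →+ τ.PreL2) fun x => ?_).uniformContinuous
  exact τ.preL2_norm_star (τ.toPreL2.symm x)

theorem continuous_conj : Continuous τ.conj := UniformSpace.Completion.continuous_map

theorem conj_toL2 (x : M.toStarSubalgebra) : τ.conj (τ.toL2 x) = τ.toL2 (star x) :=
  UniformSpace.Completion.map_coe τ.uniformContinuous_star (τ.toPreL2 x)

/-- On M both sides are values of the bilinear form τ(xy), so this is traciality, extended by
density. -/
theorem inner_conj (x y : τ.L2) : ⟪τ.conj x, y⟫_ℂ = ⟪τ.conj y, x⟫_ℂ := by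
  have hc := τ.continuous_conj
  refine τ.denseRange_toL2.induction_on₂ (p := fun x y => ⟪τ.conj x, y⟫_ℂ = ⟪τ.conj y, x⟫_ℂ)
    (isClosed_eq (by fun_prop) (by fun_prop)) (fun a b => ?_) x y
  rw [conj_toL2, conj_toL2, inner_toL2, inner_toL2, star_star, star_star, τ.tracial]

theorem conj_rightMul_leftMul (a b : M.toStarSubalgebra) (x : τ.L2) :
    τ.conj (τ.rightMul b (τ.leftMul a x)) = τ.leftMul (star b) (τ.rightMul (star a) (τ.conj x)) := by
  have hc := τ.continuous_conj
  refine τ.denseRange_toL2.induction_on (p := fun x => τ.conj (τ.rightMul b (τ.leftMul a x)) =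
    τ.leftMul (star b) (τ.rightMul (star a) (τ.conj x))) x
    (isClosed_eq (by fun_prop) (by fun_prop)) (fun x => ?_)
  simp [conj_toL2, leftMul_toL2, rightMul_toL2]

theorem apply_toL2_eq_rightMul {S : τ.L2 →L[ℂ] τ.L2}
    (hS : ∀ b x, S (τ.rightMul b x) = τ.rightMul b (S x)) (b : M.toStarSubalgebra) :
    S (τ.toL2 b) = τ.rightMul b (S (τ.toL2 1)) := by
  rw [← hS, rightMul_toL2, one_mul]

theorem apply_toL2_eq_leftMul {T : τ.L2 →L[ℂ] τ.L2}
    (hT : ∀ a x, T (τ.leftMul a x) = τ.leftMul a (T x)) (a : M.toStarSubalgebra) :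
    T (τ.toL2 a) = τ.leftMul a (T (τ.toL2 1)) := by
  rw [← hT, leftMul_toL2, mul_one]

theorem adjoint_rightMul_comm {S : τ.L2 →L[ℂ] τ.L2}
    (hS : ∀ b x, S (τ.rightMul b x) = τ.rightMul b (S x)) (b : M.toStarSubalgebra) (x : τ.L2) :
    adjoint S (τ.rightMul b x) = τ.rightMul b (adjoint S x) := by
  refine ext_inner_left ℂ fun v => ?_
  rw [adjoint_inner_right, ← adjoint_inner_left, rightMul_adjoint, ← hS,
    ← adjoint_inner_right, ← rightMul_adjoint, adjoint_inner_left]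

theorem adjoint_leftMul_comm {S : τ.L2 →L[ℂ] τ.L2}
    (hS : ∀ b x, S (τ.leftMul b x) = τ.leftMul b (S x)) (b : M.toStarSubalgebra) (x : τ.L2) :
    adjoint S (τ.leftMul b x) = τ.leftMul b (adjoint S x) := by
  refine ext_inner_left ℂ fun v => ?_
  rw [adjoint_inner_right, ← adjoint_inner_left, leftMul_adjoint, ← hS,
    ← adjoint_inner_right, ← leftMul_adjoint, adjoint_inner_left]

/-- Such an S acts on M as b ↦ (S1)b, so pairing S*1 with b only involves S1, and the symmetry of
the conjugation finishes. -/
theorem adjoint_apply_one_of_rightMul_comm {S : τ.L2 →L[ℂ] τ.L2}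
    (hS : ∀ b x, S (τ.rightMul b x) = τ.rightMul b (S x)) :
    adjoint S (τ.toL2 1) = τ.conj (S (τ.toL2 1)) := by
  refine τ.ext_inner_toL2 fun b => ?_
  rw [adjoint_inner_right, τ.apply_toL2_eq_rightMul hS, ← inner_conj_symm (τ.toL2 b),
    inner_conj, inner_conj_symm, conj_toL2, ← adjoint_inner_right, rightMul_adjoint,
    rightMul_toL2, one_mul]

theorem adjoint_apply_one_of_leftMul_comm {T : τ.L2 →L[ℂ] τ.L2}
    (hT : ∀ a x, T (τ.leftMul a x) = τ.leftMul a (T x)) :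
    adjoint T (τ.toL2 1) = τ.conj (T (τ.toL2 1)) := by
  refine τ.ext_inner_toL2 fun b => ?_
  rw [adjoint_inner_right, τ.apply_toL2_eq_leftMul hT, ← inner_conj_symm (τ.toL2 b),
    inner_conj, inner_conj_symm, conj_toL2, ← adjoint_inner_right, leftMul_adjoint,
    leftMul_toL2, mul_one]

/-- The commutants of the left and of the right multiplications on `L²(M)` commute. -/
theorem comm_of_rightMul_comm_of_leftMul_comm {S T : τ.L2 →L[ℂ] τ.L2}
    (hS : ∀ b x, S (τ.rightMul b x) = τ.rightMul b (S x))
    (hT : ∀ a x, T (τ.leftMul a x) = τ.leftMul a (T x)) (x : τ.L2) : S (T x) = T (S x) := by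
  -- Moving one factor across, the matrix coefficients become ⟪(J S1)b, a(T1)⟫ and ⟪b(J T1), (S1)a⟫,
  -- with J the conjugation; these agree by `inner_conj`.
  have : S ∘L T = T ∘L S := τ.ext_toL2 fun a => τ.ext_inner_toL2 fun b => by
    simp only [comp_apply]
    rw [← adjoint_inner_left S (T _), ← adjoint_inner_left T (S _), τ.apply_toL2_eq_leftMul hT,
      τ.apply_toL2_eq_rightMul hS, τ.apply_toL2_eq_rightMul (τ.adjoint_rightMul_comm hS),
      τ.apply_toL2_eq_leftMul (τ.adjoint_leftMul_comm hT),
      τ.adjoint_apply_one_of_rightMul_comm hS, τ.adjoint_apply_one_of_leftMul_comm hT,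
      ← adjoint_inner_right, rightMul_adjoint, inner_conj, conj_rightMul_leftMul,
      star_star, leftMul_rightMul, ← rightMul_adjoint, adjoint_inner_left]
  exact congrArg (fun T => T x) this

end TracialState
end FreeProb

namespace FreeProb

open ContinuousLinearMap

/-! ### Bounded vectors and density -/

/-- If `W* W` commutes with `S`, then `‖W S z‖ ≤ ‖S‖ ‖W z‖`. -/
theorem norm_apply_le_of_commute {E F : Type*} [NormedAddCommGroup E] [InnerProductSpace ℂ E]
    [CompleteSpace E] [NormedAddCommGroup F] [InnerProductSpace ℂ F] [CompleteSpace F]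
    {W : E →L[ℂ] F} {S : E →L[ℂ] E} (h : Commute (adjoint W ∘L W) S) (z : E) :
    ‖W (S z)‖ ≤ ‖S‖ * ‖W z‖ := by
  set D : E →L[ℂ] E := adjoint W ∘L W with hD
  have hpos : 0 ≤ D := (nonneg_iff_isPositive D).2 (isPositive_adjoint_comp_self W)
  -- Replace W by |W| = √(W*W): it has the same norms on vectors and, by functional calculus,
  -- commutes with S.
  have hT : Commute (CFC.sqrt D) S := h.cfcₙ_nnreal NNReal.sqrt
  have hsa : adjoint (CFC.sqrt D) = CFC.sqrt D := (CFC.sqrt_nonneg D).isSelfAdjoint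
  have hn : ∀ z, ‖W z‖ = ‖CFC.sqrt D z‖ := fun z => by
    have h₁ : ⟪CFC.sqrt D z, CFC.sqrt D z⟫_ℂ = ⟪W z, W z⟫_ℂ := by
      rw [← adjoint_inner_left, hsa, ← mul_apply_eq_comp, CFC.sqrt_mul_sqrt_self D hpos,
        hD, comp_apply, adjoint_inner_left]
    rw [← sq_eq_sq₀ (norm_nonneg _) (norm_nonneg _), ← inner_self_eq_norm_sq (𝕜 := ℂ),
      ← inner_self_eq_norm_sq (𝕜 := ℂ), h₁]
  rw [hn, hn, ← mul_apply_eq_comp, hT.eq, mul_apply_eq_comp]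
  exact S.le_opNorm _

namespace TracialState

variable {H : Type*} [NormedAddCommGroup H] [InnerProductSpace ℂ H] [CompleteSpace H]
  {M : VonNeumannAlgebra H} (τ : TracialState M)

theorem norm_toL2 (x : M.toStarSubalgebra) : ‖τ.toL2 x‖ = ‖τ.toPreL2 x‖ :=
  UniformSpace.Completion.norm_coe _

/-- By normality, `M` acts on `L²(M)` as a subrepresentation of a multiple of `H`. -/
theorem exists_intertwiners : ∃ (h : ℕ → H) (W : ℕ → τ.L2 →L[ℂ] H),
    (∀ k x, W k (τ.toL2 x) = (x : H →L[ℂ] H) (h k)) ∧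
      ∀ z, (∀ k, W k z = 0) → z = 0 := by
  obtain ⟨h, hh⟩ := τ.exists_hasSum_norm
  have hsum : ∀ x : M.toStarSubalgebra,
      HasSum (fun k => ‖(x : H →L[ℂ] H) (h k)‖ ^ 2) (‖τ.toL2 x‖ ^ 2) := fun x => by
    rw [norm_toL2, preL2_norm_sq]
    exact hh x
  let f : ℕ → M.toStarSubalgebra →ₗ[ℂ] H := fun k =>
    { toFun := fun x => (x : H →L[ℂ] H) (h k)
      map_add' := fun _ _ => rfl
      map_smul' := fun _ _ => rfl }
  have hf : ∀ k x, ‖f k x‖ ≤ 1 * ‖τ.toL2 x‖ := fun k x => by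
    rw [one_mul, ← sq_le_sq₀ (norm_nonneg _) (norm_nonneg _)]
    exact le_hasSum (hsum x) k fun _ _ => by positivity
  have hW : ∀ k x, (f k).extendOfNorm τ.toL2 (τ.toL2 x) = (x : H →L[ℂ] H) (h k) := fun k x =>
    LinearMap.extendOfNorm_eq τ.denseRange_toL2 ⟨1, hf k⟩ x
  refine ⟨h, fun k => (f k).extendOfNorm τ.toL2, hW, fun z hz => ?_⟩
  set W := fun k => (f k).extendOfNorm τ.toL2
  -- A Bessel inequality on all of L²(M). Only finite sums are needed, and these are continuous in
  -- z.
  have hle : ∀ (s : Finset ℕ) (z : τ.L2), ∑ k ∈ s, ‖W k z‖ ^ 2 ≤ ‖z‖ ^ 2 := fun s z =>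
    τ.denseRange_toL2.induction_on (p := fun z => ∑ k ∈ s, ‖W k z‖ ^ 2 ≤ ‖z‖ ^ 2) z
      (isClosed_le (by fun_prop) (by fun_prop)) fun x => by
        simp only [W, hW]
        exact sum_le_hasSum _ (fun _ _ => by positivity) (hsum x)
  -- If every Wₖ kills z, then x and x - z have the same images, whose square norms sum to exactly
  -- ‖x‖². Letting x tend to z forces z = 0.
  have hx : ∀ x : M.toStarSubalgebra, ‖τ.toL2 x‖ ≤ ‖τ.toL2 x - z‖ := fun x => by
    rw [← sq_le_sq₀ (norm_nonneg _) (norm_nonneg _)]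
    refine hasSum_le_of_sum_le (hsum x) fun s => ?_
    refine le_trans (le_of_eq (Finset.sum_congr rfl fun k _ => ?_)) (hle s (τ.toL2 x - z))
    rw [map_sub, hz k, sub_zero, hW]
  have : ‖z‖ ≤ ‖z - z‖ :=
    τ.denseRange_toL2.induction_on (p := fun y => ‖y‖ ≤ ‖y - z‖) z
      (isClosed_le (by fun_prop) (by fun_prop)) hx
  simpa using this

/-- The bounded `M`-linear maps from `L²(M)` to `H`. -/
noncomputable def intertwiners : Submodule ℂ (τ.L2 →L[ℂ] H) where
  carrier := {W | ∀ (a : M.toStarSubalgebra) z, W (τ.leftMul a z) = (a : H →L[ℂ] H) (W z)}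
  add_mem' h₁ h₂ a z := by simp [h₁ a z, h₂ a z]
  zero_mem' a z := by simp
  smul_mem' r W h a z := by simp [h a z]

theorem mem_intertwiners_of_toL2 {W : τ.L2 →L[ℂ] H} {v : H}
    (h : ∀ x : M.toStarSubalgebra, W (τ.toL2 x) = (x : H →L[ℂ] H) v) : W ∈ τ.intertwiners := by
  intro a z
  have : W ∘L τ.leftMul a = (a : H →L[ℂ] H) ∘L W := τ.ext_toL2 fun x => by
    simp [leftMul_toL2, h]
  exact congrArg (fun T => T z) this

/-- This makes the values of intertwiners at a fixed vector invariant under the commutant of M,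
hence accessible to the double commutant theorem. -/
theorem commutant_comp_mem_intertwiners {T : H →L[ℂ] H} (hT : T ∈ M.commutant)
    {W : τ.L2 →L[ℂ] H} (hW : W ∈ τ.intertwiners) : T ∘L W ∈ τ.intertwiners := by
  intro a z
  have := congrArg (fun S => S (W z)) (VonNeumannAlgebra.mem_commutant_iff.1 hT a a.2)
  simp only [mul_apply_eq_comp] at this
  rw [comp_apply, comp_apply, hW a z, this]

theorem adjoint_leftMul_of_mem_intertwiners {W : τ.L2 →L[ℂ] H} (hW : W ∈ τ.intertwiners)
    (a : M.toStarSubalgebra) (v : H) :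
    adjoint W ((a : H →L[ℂ] H) v) = τ.leftMul a (adjoint W v) := by
  refine ext_inner_left ℂ fun z => ?_
  have h : adjoint (a : H →L[ℂ] H) = ((star a : M.toStarSubalgebra) : H →L[ℂ] H) := rfl
  rw [adjoint_inner_right, ← adjoint_inner_left, h, ← hW, ← adjoint_inner_right,
    ← leftMul_adjoint, adjoint_inner_left]

/-- Evaluation at `1` of the bounded `M`-linear maps from `L²(M)` to `H`. -/
noncomputable def evalIntertwiner (z : τ.L2) : τ.intertwiners →ₗ[ℂ] H where
  toFun W := (W : τ.L2 →L[ℂ] H) z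
  map_add' _ _ := rfl
  map_smul' _ _ := rfl

/-- The closed span K of the values is invariant under the commutant, so its projection p lies in M.
As K contains every hₖ, all Wₖ kill 1 - p, and p = 1. -/
theorem denseRange_evalIntertwiner : DenseRange (τ.evalIntertwiner (τ.toL2 1)) := by
  obtain ⟨h, W, hW, hinj⟩ := τ.exists_intertwiners
  set K := (LinearMap.range (τ.evalIntertwiner (τ.toL2 1))).topologicalClosure with hK
  have hcl : IsClosed (K : Set H) := Submodule.isClosed_topologicalClosure _
  have : CompleteSpace K := hcl.completeSpace_coe
  have he : K.starProjection ∈ M := by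
    refine (VonNeumannAlgebra.IsStarProjection.mem_iff isStarProjection_starProjection M).2
      fun y hy => ?_
    rw [Submodule.range_starProjection, Module.End.mem_invtSubmodule]
    intro v hv
    refine map_mem_closure y.continuous hv ?_
    rintro _ ⟨V, rfl⟩
    exact ⟨⟨_, τ.commutant_comp_mem_intertwiners hy V.2⟩, rfl⟩
  have h1 : (1 : M.toStarSubalgebra) - ⟨K.starProjection, he⟩ = 0 := by
    refine τ.toL2_injective ?_
    rw [map_zero]
    refine hinj _ fun k => ?_
    rw [hW]
    have hmem : h k ∈ K := by
      refine Submodule.le_topologicalClosure _ ⟨⟨W k, τ.mem_intertwiners_of_toL2 (hW k)⟩, ?_⟩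
      exact (hW k 1).trans rfl
    have := Submodule.starProjection_eq_self_iff.2 hmem
    simp [this]
  have h2 : K.starProjection = 1 := by
    have := congrArg (fun x : M.toStarSubalgebra => (x : H →L[ℂ] H)) (sub_eq_zero.1 h1)
    exact this.symm
  intro v
  have : v ∈ K := by
    rw [← Submodule.starProjection_eq_self_iff, h2]; rfl
  exact this

/-- The commutation theorem: a bounded operator on `L²(M)` commuting with the right
multiplications maps `1` into `M`. -/
theorem apply_one_mem_bounded {S : τ.L2 →L[ℂ] τ.L2}
    (hS : ∀ b x, S (τ.rightMul b x) = τ.rightMul b (S x)) : S (τ.toL2 1) ∈ τ.bounded := by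
  obtain ⟨h, W, hW, hinj⟩ := τ.exists_intertwiners
  set e := τ.evalIntertwiner (τ.toL2 1)
  set f := τ.evalIntertwiner (S (τ.toL2 1))
  -- V*V commutes with left multiplications, hence with S. So V1 ↦ V(S1) is bounded on a dense
  -- subspace of H and extends to y.
  have hbd : ∀ V, ‖f V‖ ≤ ‖S‖ * ‖e V‖ := fun V => by
    refine norm_apply_le_of_commute ?_ _
    refine ContinuousLinearMap.ext fun x => ?_
    refine (τ.comm_of_rightMul_comm_of_leftMul_comm (T := adjoint (V : τ.L2 →L[ℂ] H) ∘L V) hS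
      (fun a x => ?_) x).symm
    rw [comp_apply, comp_apply, V.2, τ.adjoint_leftMul_of_mem_intertwiners V.2]
  set y := f.extendOfNorm e
  have hy : ∀ V, y (e V) = f V :=
    LinearMap.extendOfNorm_eq τ.denseRange_evalIntertwiner ⟨_, hbd⟩
  -- For T in the commutant, TV is again an intertwiner, so y commutes with T and lies in the double
  -- commutant.
  have hyM : y ∈ M := by
    rw [← M.commutant_commutant, VonNeumannAlgebra.mem_commutant_iff]
    intro T hT
    refine ContinuousLinearMap.coeFn_injective (τ.denseRange_evalIntertwiner.equalizer
      (T * y).continuous (y * T).continuous (funext fun V => ?_))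
    have h1 : T (e V) = e ⟨_, τ.commutant_comp_mem_intertwiners hT V.2⟩ := rfl
    change T (y (e V)) = y (T (e V))
    rw [h1, hy, hy]
    rfl
  -- Taking V = Wₖ gives y hₖ = Wₖ(S1), so y and S1 have the same image under every Wₖ.
  refine ⟨⟨y, hyM⟩, sub_eq_zero.1 (hinj _ fun k => ?_)⟩
  rw [map_sub, hW, sub_eq_zero]
  have := hy ⟨W k, τ.mem_intertwiners_of_toL2 (hW k)⟩
  have h2 : e ⟨W k, τ.mem_intertwiners_of_toL2 (hW k)⟩ = h k := (hW k 1).trans rfl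
  rw [h2] at this
  exact this

/-- A `*`-subalgebra generating `M` is dense in `L²(M)`. -/
theorem dense_of_vonNeumannGenerated {S : Set (H →L[ℂ] H)} (hM : M = vonNeumannGenerated S)
    (A : StarSubalgebra ℂ M.toStarSubalgebra)
    (hA : ∀ T ∈ S, ∃ a ∈ A, (a : H →L[ℂ] H) = T) : Dense (τ.toL2 '' A) := by
  obtain ⟨h, W, hW, hinj⟩ := τ.exists_intertwiners
  have hWi := fun k => τ.mem_intertwiners_of_toL2 (hW k)
  set Q := (A.toSubalgebra.toSubmodule.map τ.toL2).topologicalClosure with hQ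
  have hcl : IsClosed (Q : Set τ.L2) := Submodule.isClosed_topologicalClosure _
  have : CompleteSpace Q := hcl.completeSpace_coe
  have hinv : ∀ a ∈ A, ∀ z ∈ Q, τ.leftMul a z ∈ Q := by
    intro a ha z hz
    refine map_mem_closure (τ.leftMul a).continuous hz ?_
    rintro _ ⟨x, hx, rfl⟩
    exact ⟨a * x, A.mul_mem ha hx, (τ.leftMul_toL2 a x).symm⟩
  have hcomm : ∀ a ∈ A, ∀ z, τ.leftMul a (Q.starProjection z) = Q.starProjection (τ.leftMul a z) := by
    intro a ha z
    refine (Submodule.eq_starProjection_of_mem_orthogonal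
      (hinv a ha _ (Q.starProjection_apply_mem z)) ?_).symm
    rw [← map_sub]
    intro w hw
    rw [← adjoint_inner_left, leftMul_adjoint]
    exact Q.sub_starProjection_mem_orthogonal z _ (hinv _ (star_mem ha) w hw)
  have hx : ∀ x : M.toStarSubalgebra, τ.toL2 x ∈ Q := by
    intro x
    -- The projection onto Q acts on L²(M), while generation is a statement on H. Compressing by the
    -- intertwiners gives operators on H commuting with S and S*, hence with M.
    have hp : ∀ k l, W k ∘L Q.starProjection ∘L adjoint (W l) ∈ StarSubalgebra.centralizer ℂ S := by
      intro k l
      have key : ∀ a ∈ A, (a : H →L[ℂ] H) * (W k ∘L Q.starProjection ∘L adjoint (W l)) =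
          (W k ∘L Q.starProjection ∘L adjoint (W l)) * (a : H →L[ℂ] H) := by
        intro a ha
        ext v
        simp only [mul_apply_eq_comp, comp_apply]
        rw [τ.adjoint_leftMul_of_mem_intertwiners (hWi l), ← hcomm a ha, hWi k]
      rintro T (hT | hT)
      · obtain ⟨a, ha, rfl⟩ := hA T hT
        exact key a ha
      · obtain ⟨a, ha, haT⟩ := hA (star T) hT
        have : T = ((star a : M.toStarSubalgebra) : H →L[ℂ] H) := by
          rw [StarMemClass.coe_star, haT, star_star]
        rw [this]
        exact key _ (star_mem ha)
    have hxc : ∀ k l, (x : H →L[ℂ] H) * (W k ∘L Q.starProjection ∘L adjoint (W l)) =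
        (W k ∘L Q.starProjection ∘L adjoint (W l)) * (x : H →L[ℂ] H) := fun k l => by
      have hx2 : (x : H →L[ℂ] H) ∈ vonNeumannGenerated S := hM ▸ x.2
      exact (hx2 _ (Or.inl (hp k l))).symm
    -- The compressions are undone in two steps: joint injectivity of the Wₖ cancels the left
    -- factor, and the resulting totality of the ranges of the Wₗ* cancels the right one.
    have h1 : ∀ l v, τ.leftMul x (Q.starProjection (adjoint (W l) v)) =
        Q.starProjection (τ.leftMul x (adjoint (W l) v)) := fun l v => by
      refine sub_eq_zero.1 (hinj _ fun k => ?_)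
      have := congrArg (fun T => T v) (hxc k l)
      simp only [mul_apply_eq_comp, comp_apply] at this
      rw [τ.adjoint_leftMul_of_mem_intertwiners (hWi l)] at this
      rw [map_sub, hWi k, this, sub_self]
    have h2 : ∀ z, adjoint (τ.leftMul x ∘L Q.starProjection - Q.starProjection ∘L τ.leftMul x) z = 0 :=
      fun z => hinj _ fun l => by
        refine ext_inner_right ℂ fun v => ?_
        rw [← adjoint_inner_right, adjoint_inner_left]
        simp [h1]
    have h3 : τ.leftMul x (Q.starProjection (τ.toL2 1)) =
        Q.starProjection (τ.leftMul x (τ.toL2 1)) := by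
      refine sub_eq_zero.1 (ext_inner_left ℂ fun z => ?_)
      have := adjoint_inner_left (τ.leftMul x ∘L Q.starProjection - Q.starProjection ∘L τ.leftMul x)
        (τ.toL2 1) z
      rw [h2, inner_zero_left] at this
      rw [inner_zero_right]
      exact this.symm
    have h4 : τ.toL2 1 ∈ Q := Submodule.le_topologicalClosure _ ⟨1, one_mem A, rfl⟩
    rw [Submodule.starProjection_eq_self_iff.2 h4, leftMul_toL2, mul_one] at h3
    exact Submodule.starProjection_eq_self_iff.1 h3.symm
  intro z
  exact τ.denseRange_toL2.induction_on (p := fun z => z ∈ Q) z hcl hx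

end TracialState
end FreeProb

namespace FreeProb

open ContinuousLinearMap

/-! ### The free difference quotients on noncommutative polynomials -/

section FreeAlgebra

variable {n : ℕ}

/-- Induction on noncommutative polynomials, by left multiplication by the variables. -/
theorem freeAlgebra_induction_left {p : FreeAlgebra ℂ (Fin n) → Prop} (one : p 1)
    (add : ∀ P Q, p P → p Q → p (P + Q)) (smul : ∀ (r : ℂ) P, p P → p (r • P))
    (ι_mul : ∀ k P, p P → p (FreeAlgebra.ι ℂ k * P)) (P : FreeAlgebra ℂ (Fin n)) : p P := by
  have key : ∀ Q, p Q → p (P * Q) := by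
    induction P using FreeAlgebra.induction with
    | grade0 r => intro Q hQ; rw [← Algebra.smul_def]; exact smul r Q hQ
    | grade1 k => exact ι_mul k
    | mul a b ha hb => intro Q hQ; rw [mul_assoc]; exact ha _ (hb _ hQ)
    | add a b ha hb => intro Q hQ; rw [add_mul]; exact add _ _ (ha _ hQ) (hb _ hQ)
  simpa using key 1 one

/-- Induction on noncommutative polynomials, by right multiplication by the variables. -/
theorem freeAlgebra_induction_right {p : FreeAlgebra ℂ (Fin n) → Prop} (one : p 1)
    (add : ∀ P Q, p P → p Q → p (P + Q)) (smul : ∀ (r : ℂ) P, p P → p (r • P))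
    (mul_ι : ∀ k P, p P → p (P * FreeAlgebra.ι ℂ k)) (P : FreeAlgebra ℂ (Fin n)) : p P := by
  have key : ∀ Q, p Q → p (Q * P) := by
    induction P using FreeAlgebra.induction with
    | grade0 r =>
      intro Q hQ; rw [← Algebra.commutes, ← Algebra.smul_def]; exact smul r Q hQ
    | grade1 k => exact mul_ι k
    | mul a b ha hb => intro Q hQ; rw [← mul_assoc]; exact hb _ (ha _ hQ)
    | add a b ha hb => intro Q hQ; rw [mul_add]; exact add _ _ (ha _ hQ) (hb _ hQ)
  simpa using key 1 one

theorem freeDiff_one (i : Fin n) : freeDiff i 1 = 0 := by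
  have h := freeDiff_mul i 1 1
  rw [← Algebra.TensorProduct.one_def, one_mul, one_mul, mul_one] at h
  simpa using h

theorem freeDiff_ι_mul (i k : Fin n) (P : FreeAlgebra ℂ (Fin n)) :
    freeDiff i (FreeAlgebra.ι ℂ k * P) =
      (FreeAlgebra.ι ℂ k ⊗ₜ 1) * freeDiff i P + if k = i then 1 ⊗ₜ P else 0 := by
  rw [freeDiff_mul, freeDiff_ι]
  split_ifs <;> simp

theorem freeDiff_mul_ι (i k : Fin n) (P : FreeAlgebra ℂ (Fin n)) :
    freeDiff i (P * FreeAlgebra.ι ℂ k) =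
      freeDiff i P * (1 ⊗ₜ FreeAlgebra.ι ℂ k) + if k = i then P ⊗ₜ 1 else 0 := by
  rw [freeDiff_mul, freeDiff_ι, add_comm]
  split_ifs <;> simp

/-- Coassociativity of the free difference quotient. -/
theorem freeDiff_coassoc (i : Fin n) (P : FreeAlgebra ℂ (Fin n)) :
    TensorProduct.assoc ℂ _ _ _ ((freeDiff i).rTensor _ (freeDiff i P)) =
      (freeDiff i).lTensor _ (freeDiff i P) := by
  induction P using freeAlgebra_induction_left with
  | one => simp [freeDiff_one]
  | add P Q hP hQ => simp only [map_add, hP, hQ]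
  | smul r P hP => simp only [map_smul, hP]
  | ι_mul k P hP =>
    -- L multiplies the first of three legs by the variable. Both iterated quotients intertwine with
    -- L up to the same extra term 1 ⊗ ∂ᵢP when k = i: on the left from differentiating the variable
    -- again, on the right from differentiating 1 ⊗ P.
    let L := (LinearMap.mulLeft ℂ (FreeAlgebra.ι ℂ k)).rTensor
      (FreeAlgebra ℂ (Fin n) ⊗[ℂ] FreeAlgebra ℂ (Fin n))
    have h₁ : ∀ t : FreeAlgebra ℂ (Fin n) ⊗[ℂ] FreeAlgebra ℂ (Fin n),
        TensorProduct.assoc ℂ _ _ _ ((freeDiff i).rTensor _ ((FreeAlgebra.ι ℂ k ⊗ₜ 1) * t)) =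
          L (TensorProduct.assoc ℂ _ _ _ ((freeDiff i).rTensor _ t)) +
            if k = i then 1 ⊗ₜ t else 0 := by
      intro t
      induction t using TensorProduct.induction_on with
      | zero => simp
      | tmul p q =>
        have h₂ : ∀ s : FreeAlgebra ℂ (Fin n) ⊗[ℂ] FreeAlgebra ℂ (Fin n),
            TensorProduct.assoc ℂ _ _ _ (((FreeAlgebra.ι ℂ k ⊗ₜ[ℂ] 1) * s) ⊗ₜ[ℂ] q) =
              L (TensorProduct.assoc ℂ _ _ _ (s ⊗ₜ[ℂ] q)) := by
          intro s
          induction s using TensorProduct.induction_on with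
          | zero => simp
          | tmul a b => simp [L]
          | add a b ha hb => simp only [mul_add, TensorProduct.add_tmul, map_add, ha, hb]
        rw [Algebra.TensorProduct.tmul_mul_tmul, one_mul, LinearMap.rTensor_tmul, freeDiff_ι_mul,
          TensorProduct.add_tmul, map_add, h₂, LinearMap.rTensor_tmul]
        split_ifs <;> simp
      | add a b ha hb =>
        simp only [mul_add, map_add, ha, hb]
        split_ifs
        · rw [TensorProduct.tmul_add]; abel
        · abel
    have h₃ : ∀ t : FreeAlgebra ℂ (Fin n) ⊗[ℂ] FreeAlgebra ℂ (Fin n),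
        (freeDiff i).lTensor _ ((FreeAlgebra.ι ℂ k ⊗ₜ 1) * t) = L ((freeDiff i).lTensor _ t) := by
      intro t
      induction t using TensorProduct.induction_on with
      | zero => simp
      | tmul p q => simp [L]
      | add a b ha hb => simp only [mul_add, map_add, ha, hb]
    rw [freeDiff_ι_mul, map_add, map_add, map_add, h₁, h₃, hP]
    split_ifs <;> simp [freeDiff_one]

end FreeAlgebra

/-! ### The free difference quotients on `L²(M)` -/

section L2

variable {H : Type*} [NormedAddCommGroup H] [InnerProductSpace ℂ H] [CompleteSpace H]
  {M : VonNeumannAlgebra H} (τ : TracialState M) {n : ℕ} (X : Fin n → M.toStarSubalgebra)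

/-- The evaluation of tensors of noncommutative polynomials in `L²(M) ⊗ L²(M)`. -/
noncomputable def evalTensor :
    FreeAlgebra ℂ (Fin n) ⊗[ℂ] FreeAlgebra ℂ (Fin n) →ₗ[ℂ] τ.L2L2 :=
  (toHilbertTensor τ.L2 τ.L2).toLinearMap ∘ₗ TensorProduct.map (evalL2 τ X) (evalL2 τ X)

theorem evalTensor_tmul (P Q : FreeAlgebra ℂ (Fin n)) :
    evalTensor τ X (P ⊗ₜ Q) = htmul (evalL2 τ X P) (evalL2 τ X Q) := rfl

theorem freeDiffL2_apply (i : Fin n) (P : FreeAlgebra ℂ (Fin n)) :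
    freeDiffL2 τ X i P = evalTensor τ X (freeDiff i P) := rfl

theorem evalL2_one : evalL2 τ X 1 = τ.toL2 1 := by simp [evalL2]

theorem evalL2_ι_mul (k : Fin n) (P : FreeAlgebra ℂ (Fin n)) :
    evalL2 τ X (FreeAlgebra.ι ℂ k * P) = τ.leftMul (X k) (evalL2 τ X P) := by
  simp [evalL2, TracialState.leftMul_toL2, evalPoly]

theorem evalL2_mul_ι (k : Fin n) (P : FreeAlgebra ℂ (Fin n)) :
    evalL2 τ X (P * FreeAlgebra.ι ℂ k) = τ.rightMul (X k) (evalL2 τ X P) := by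
  simp [evalL2, TracialState.rightMul_toL2, evalPoly]

theorem evalTensor_ι_mul (k : Fin n) (t : FreeAlgebra ℂ (Fin n) ⊗[ℂ] FreeAlgebra ℂ (Fin n)) :
    evalTensor τ X ((FreeAlgebra.ι ℂ k ⊗ₜ 1) * t) =
      htensorMap (τ.leftMul (X k)) (.id ℂ _) (evalTensor τ X t) := by
  induction t using TensorProduct.induction_on with
  | zero => simp
  | tmul p q => simp [evalTensor_tmul, evalL2_ι_mul, htensorMap_htmul]
  | add a b ha hb => simp only [mul_add, map_add, ha, hb]

theorem evalTensor_mul_ι (k : Fin n) (t : FreeAlgebra ℂ (Fin n) ⊗[ℂ] FreeAlgebra ℂ (Fin n)) :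
    evalTensor τ X (t * (1 ⊗ₜ FreeAlgebra.ι ℂ k)) =
      htensorMap (.id ℂ _) (τ.rightMul (X k)) (evalTensor τ X t) := by
  induction t using TensorProduct.induction_on with
  | zero => simp
  | tmul p q => simp [evalTensor_tmul, evalL2_mul_ι, htensorMap_htmul]
  | add a b ha hb => simp only [add_mul, map_add, ha, hb]

theorem freeDiffL2_one (i : Fin n) : freeDiffL2 τ X i 1 = 0 := by
  rw [freeDiffL2_apply, freeDiff_one, map_zero]

theorem freeDiffL2_ι_mul (i k : Fin n) (P : FreeAlgebra ℂ (Fin n)) :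
    freeDiffL2 τ X i (FreeAlgebra.ι ℂ k * P) =
      htensorMap (τ.leftMul (X k)) (.id ℂ _) (freeDiffL2 τ X i P) +
        if k = i then htmul (τ.toL2 1) (evalL2 τ X P) else 0 := by
  rw [freeDiffL2_apply, freeDiff_ι_mul, map_add, evalTensor_ι_mul, freeDiffL2_apply]
  split_ifs
  · rw [evalTensor_tmul, evalL2_one]
  · rw [map_zero]

theorem freeDiffL2_mul_ι (i k : Fin n) (P : FreeAlgebra ℂ (Fin n)) :
    freeDiffL2 τ X i (P * FreeAlgebra.ι ℂ k) =
      htensorMap (.id ℂ _) (τ.rightMul (X k)) (freeDiffL2 τ X i P) +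
        if k = i then htmul (evalL2 τ X P) (τ.toL2 1) else 0 := by
  rw [freeDiffL2_apply, freeDiff_mul_ι, map_add, evalTensor_mul_ι, freeDiffL2_apply]
  split_ifs
  · rw [evalTensor_tmul, evalL2_one]
  · rw [map_zero]

theorem denseRange_evalL2 (hsa : ∀ i, IsSelfAdjoint (X i))
    (hgen : M = vonNeumannGenerated (Set.range fun i => (X i : H →L[ℂ] H))) :
    DenseRange (evalL2 τ X) := by
  have hstar : ∀ P : FreeAlgebra ℂ (Fin n), star (evalPoly X P) ∈ (evalPoly X).range := by
    intro P
    induction P using freeAlgebra_induction_left with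
    | one => simp
    | add P Q hP hQ => rw [map_add, star_add]; exact add_mem hP hQ
    | smul r P hP => rw [map_smul, star_smul]; exact Subalgebra.smul_mem _ hP _
    | ι_mul k P hP =>
      rw [map_mul, star_mul]
      refine mul_mem hP ⟨FreeAlgebra.ι ℂ k, ?_⟩
      simpa [evalPoly] using (hsa k).symm
  let A : StarSubalgebra ℂ M.toStarSubalgebra :=
    { (evalPoly X).range with
      star_mem' := by rintro _ ⟨P, rfl⟩; exact hstar P }
  have := τ.dense_of_vonNeumannGenerated hgen A (by
    rintro _ ⟨i, rfl⟩
    exact ⟨X i, ⟨FreeAlgebra.ι ℂ i, by simp [evalPoly]⟩, rfl⟩)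
  refine this.mono ?_
  rintro _ ⟨_, ⟨P, rfl⟩, rfl⟩
  exact ⟨P, rfl⟩

/-- `(ζ, w)` is in the graph of the adjoint of `∂ᵢ`. -/
def AdjointPair (i : Fin n) (ζ : τ.L2L2) (w : τ.L2) : Prop :=
  ∀ P, ⟪w, evalL2 τ X P⟫_ℂ = ⟪ζ, freeDiffL2 τ X i P⟫_ℂ

/-- The graph of `∂ᵢ`. -/
noncomputable def diffGraph (i : Fin n) : Submodule ℂ (τ.L2 × τ.L2L2) :=
  LinearMap.range ((evalL2 τ X).prod (freeDiffL2 τ X i))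

/-- The domain of the closure of `∂ᵢ`. -/
noncomputable def closureDomain (i : Fin n) : Submodule ℂ τ.L2 :=
  (diffGraph τ X i).topologicalClosure.map (LinearMap.fst ℂ _ _)

variable {τ X}

theorem mem_closureDomain {i : Fin n} {η : τ.L2} :
    η ∈ closureDomain τ X i ↔ ∃ θ, (η, θ) ∈ (diffGraph τ X i).topologicalClosure := by
  simp [closureDomain]

theorem closure_diffGraph_induction {i : Fin n} {p : τ.L2 → τ.L2L2 → Prop}
    (hp : IsClosed {z : τ.L2 × τ.L2L2 | p z.1 z.2})
    (h : ∀ P, p (evalL2 τ X P) (freeDiffL2 τ X i P)) {η : τ.L2} {θ : τ.L2L2}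
    (hη : (η, θ) ∈ (diffGraph τ X i).topologicalClosure) : p η θ := by
  refine closure_minimal (t := {z : τ.L2 × τ.L2L2 | p z.1 z.2}) ?_ hp hη
  rintro _ ⟨P, rfl⟩
  exact h P

theorem evalL2_mem_closureDomain (i : Fin n) (P : FreeAlgebra ℂ (Fin n)) :
    evalL2 τ X P ∈ closureDomain τ X i :=
  mem_closureDomain.2 ⟨freeDiffL2 τ X i P, Submodule.le_topologicalClosure _ ⟨P, rfl⟩⟩

/-- For fixed Xₖ the Leibniz rule is continuous in the pair (η, ∂ᵢη), so it survives passage to the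
closed graph. -/
theorem leftMul_mem_closureDomain {i : Fin n} (k : Fin n) {η : τ.L2}
    (hη : η ∈ closureDomain τ X i) : τ.leftMul (X k) η ∈ closureDomain τ X i := by
  obtain ⟨θ, hθ⟩ := mem_closureDomain.1 hη
  refine mem_closureDomain.2 ⟨htensorMap (τ.leftMul (X k)) (.id ℂ _) θ +
    if k = i then tmulLeft _ (τ.toL2 1) η else 0, ?_⟩
  refine closure_diffGraph_induction (p := fun η θ => (τ.leftMul (X k) η,
    htensorMap (τ.leftMul (X k)) (.id ℂ _) θ + if k = i then tmulLeft _ (τ.toL2 1) η else 0) ∈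
      (diffGraph τ X i).topologicalClosure) ?_ (fun P => ?_) hθ
  · refine (Submodule.isClosed_topologicalClosure _).preimage ?_
    split_ifs <;> fun_prop
  · refine Submodule.le_topologicalClosure _ ⟨FreeAlgebra.ι ℂ k * P, ?_⟩
    simp [evalL2_ι_mul, freeDiffL2_ι_mul]

theorem rightMul_mem_closureDomain {i : Fin n} (k : Fin n) {η : τ.L2}
    (hη : η ∈ closureDomain τ X i) : τ.rightMul (X k) η ∈ closureDomain τ X i := by
  obtain ⟨θ, hθ⟩ := mem_closureDomain.1 hη
  refine mem_closureDomain.2 ⟨htensorMap (.id ℂ _) (τ.rightMul (X k)) θ +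
    if k = i then tmulRight _ (τ.toL2 1) η else 0, ?_⟩
  refine closure_diffGraph_induction (p := fun η θ => (τ.rightMul (X k) η,
    htensorMap (.id ℂ _) (τ.rightMul (X k)) θ + if k = i then tmulRight _ (τ.toL2 1) η else 0) ∈
      (diffGraph τ X i).topologicalClosure) ?_ (fun P => ?_) hθ
  · refine (Submodule.isClosed_topologicalClosure _).preimage ?_
    split_ifs <;> fun_prop
  · refine Submodule.le_topologicalClosure _ ⟨P * FreeAlgebra.ι ℂ k, ?_⟩
    simp [evalL2_mul_ι, freeDiffL2_mul_ι]

theorem htensorMap_id_adjoint_left (hsa : ∀ i, IsSelfAdjoint (X i)) (k : Fin n) (u v : τ.L2L2) :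
    ⟪htensorMap (τ.leftMul (X k)) (.id ℂ _) u, v⟫_ℂ =
      ⟪u, htensorMap (τ.leftMul (X k)) (.id ℂ _) v⟫_ℂ := by
  rw [← adjoint_inner_right, htensorMap_adjoint, TracialState.leftMul_adjoint, (hsa k).star_eq,
    ContinuousLinearMap.adjoint_id]

theorem htensorMap_id_adjoint_right (hsa : ∀ i, IsSelfAdjoint (X i)) (k : Fin n) (u v : τ.L2L2) :
    ⟪htensorMap (.id ℂ _) (τ.rightMul (X k)) u, v⟫_ℂ =
      ⟪u, htensorMap (.id ℂ _) (τ.rightMul (X k)) v⟫_ℂ := by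
  rw [← adjoint_inner_right, htensorMap_adjoint, TracialState.rightMul_adjoint, (hsa k).star_eq,
    ContinuousLinearMap.adjoint_id]

/-! ### Calculus of the adjoints of the difference quotients -/

namespace AdjointPair

variable {i : Fin n} {ζ ζ' : τ.L2L2} {w w' : τ.L2}

theorem add (h : AdjointPair τ X i ζ w) (h' : AdjointPair τ X i ζ' w') :
    AdjointPair τ X i (ζ + ζ') (w + w') := fun P => by
  rw [inner_add_left, inner_add_left, h P, h' P]

theorem sub (h : AdjointPair τ X i ζ w) (h' : AdjointPair τ X i ζ' w') :
    AdjointPair τ X i (ζ - ζ') (w - w') := fun P => by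
  rw [inner_sub_left, inner_sub_left, h P, h' P]

theorem smul (r : ℂ) (h : AdjointPair τ X i ζ w) :
    AdjointPair τ X i (r • ζ) (r • w) := fun P => by
  rw [inner_smul_left, inner_smul_left, h P]

theorem inner_eq (h : AdjointPair τ X i ζ w) {η : τ.L2} {θ : τ.L2L2}
    (hη : (η, θ) ∈ (diffGraph τ X i).topologicalClosure) : ⟪w, η⟫_ℂ = ⟪ζ, θ⟫_ℂ :=
  closure_diffGraph_induction (p := fun η θ => ⟪w, η⟫_ℂ = ⟪ζ, θ⟫_ℂ)
    (isClosed_eq (by fun_prop) (by fun_prop)) h hη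

/-- Test the given pair on XₖP and move Xₖ across by self-adjointness. The Leibniz term 1 ⊗ P is
responsible for the slice of ζ by τ on the first leg. -/
theorem leftMul (hsa : ∀ i, IsSelfAdjoint (X i)) (h : AdjointPair τ X i ζ w) (k : Fin n) :
    AdjointPair τ X i (htensorMap (τ.leftMul (X k)) (.id ℂ _) ζ)
      (τ.leftMul (X k) w - if k = i then adjoint (tmulLeft _ (τ.toL2 1)) ζ else 0) := fun P => by
  have h₁ := h (FreeAlgebra.ι ℂ k * P)
  rw [evalL2_ι_mul, freeDiffL2_ι_mul, inner_add_right, ← htensorMap_id_adjoint_left hsa] at h₁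
  rw [inner_sub_left, ← adjoint_inner_right, TracialState.leftMul_adjoint, (hsa k).star_eq, h₁]
  split_ifs
  · rw [adjoint_inner_left, tmulLeft_apply, add_sub_cancel_right]
  · simp

theorem rightMul (hsa : ∀ i, IsSelfAdjoint (X i)) (h : AdjointPair τ X i ζ w) (k : Fin n) :
    AdjointPair τ X i (htensorMap (.id ℂ _) (τ.rightMul (X k)) ζ)
      (τ.rightMul (X k) w - if k = i then adjoint (tmulRight _ (τ.toL2 1)) ζ else 0) := fun P => by
  have h₁ := h (P * FreeAlgebra.ι ℂ k)
  rw [evalL2_mul_ι, freeDiffL2_mul_ι, inner_add_right, ← htensorMap_id_adjoint_right hsa] at h₁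
  rw [inner_sub_left, ← adjoint_inner_right, TracialState.rightMul_adjoint, (hsa k).star_eq, h₁]
  split_ifs
  · rw [adjoint_inner_left, tmulRight_apply, add_sub_cancel_right]
  · simp

/-- Tensors of polynomials are in the domain of `∂ᵢ*`, and `∂ᵢ*` maps them into the domain of
the closure of `∂ⱼ` if this contains the conjugate variable. -/
theorem exists_of_poly (hsa : ∀ i, IsSelfAdjoint (X i)) {ξ : τ.L2}
    (h : AdjointPair τ X i τ.oneOne ξ) {j : Fin n} (hξ : ξ ∈ closureDomain τ X j)
    (P Q : FreeAlgebra ℂ (Fin n)) : ∃ w ∈ closureDomain τ X j,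
      AdjointPair τ X i (htmul (evalL2 τ X P) (evalL2 τ X Q)) w := by
  induction Q using freeAlgebra_induction_right with
  | one =>
    rw [evalL2_one]
    induction P using freeAlgebra_induction_left with
    | one => rw [evalL2_one]; exact ⟨ξ, hξ, h⟩
    | add P Q hP hQ =>
      obtain ⟨w, hw, h₁⟩ := hP
      obtain ⟨w', hw', h₂⟩ := hQ
      exact ⟨w + w', add_mem hw hw', by simpa using h₁.add h₂⟩
    | smul r P hP =>
      obtain ⟨w, hw, h₁⟩ := hP
      exact ⟨r • w, Submodule.smul_mem _ r hw, by simpa using h₁.smul r⟩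
    | ι_mul k P hP =>
      obtain ⟨w, hw, h₁⟩ := hP
      have h₂ := h₁.leftMul hsa k
      rw [htensorMap_htmul, ← evalL2_ι_mul] at h₂
      -- The correction is a slice of a polynomial tensor, here a constant, so it stays in the
      -- domain.
      refine ⟨_, sub_mem (leftMul_mem_closureDomain k hw) ?_, h₂⟩
      split_ifs
      · rw [tmulLeft_adjoint_htmul, ← evalL2_one τ X]
        exact Submodule.smul_mem _ _ (evalL2_mem_closureDomain _ _)
      · exact zero_mem _
  | add Q Q' hQ hQ' =>
    obtain ⟨w, hw, h₁⟩ := hQ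
    obtain ⟨w', hw', h₂⟩ := hQ'
    exact ⟨w + w', add_mem hw hw', by simpa using h₁.add h₂⟩
  | smul r Q hQ =>
    obtain ⟨w, hw, h₁⟩ := hQ
    exact ⟨r • w, Submodule.smul_mem _ r hw, by simpa using h₁.smul r⟩
  | mul_ι k Q hQ =>
    obtain ⟨w, hw, h₁⟩ := hQ
    have h₂ := h₁.rightMul hsa k
    rw [htensorMap_htmul, ← evalL2_mul_ι] at h₂
    refine ⟨_, sub_mem (rightMul_mem_closureDomain k hw) ?_, h₂⟩
    split_ifs
    · rw [tmulRight_adjoint_htmul]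
      exact Submodule.smul_mem _ _ (evalL2_mem_closureDomain _ _)
    · exact zero_mem _

theorem exists_htmul_poly (hsa : ∀ i, IsSelfAdjoint (X i)) {η : τ.L2}
    (h : AdjointPair τ X i (htmul η (τ.toL2 1)) w) (Q : FreeAlgebra ℂ (Fin n)) :
    ∃ w, AdjointPair τ X i (htmul η (evalL2 τ X Q)) w := by
  induction Q using freeAlgebra_induction_right with
  | one => rw [evalL2_one]; exact ⟨w, h⟩
  | add Q Q' hQ hQ' =>
    obtain ⟨w, h₁⟩ := hQ
    obtain ⟨w', h₂⟩ := hQ'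
    exact ⟨w + w', by simpa using h₁.add h₂⟩
  | smul r Q hQ =>
    obtain ⟨w, h₁⟩ := hQ
    exact ⟨r • w, by simpa using h₁.smul r⟩
  | mul_ι k Q hQ =>
    obtain ⟨w, h₁⟩ := hQ
    have h₂ := h₁.rightMul hsa k
    rw [htensorMap_htmul, ← evalL2_mul_ι] at h₂
    exact ⟨_, h₂⟩

/-- If the conjugate variable `x = ∂ᵢ*(1 ⊗ 1)` is bounded, `∂ᵢ*(η ⊗ 1) = η x - (id ⊗ τ)(∂ᵢ η)`. -/
theorem htmul_one (hsa : ∀ i, IsSelfAdjoint (X i)) {x : M.toStarSubalgebra}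
    (h : AdjointPair τ X i τ.oneOne (τ.toL2 x)) {η : τ.L2} {θ : τ.L2L2}
    (hη : (η, θ) ∈ (diffGraph τ X i).topologicalClosure) :
    AdjointPair τ X i (htmul η (τ.toL2 1))
      (τ.rightMul x η - adjoint (tmulRight _ (τ.toL2 1)) θ) := by
  intro P
  -- For fixed P the identity is closed in (η, θ), which reduces it to polynomial η.
  refine closure_diffGraph_induction
    (p := fun η θ => ⟪τ.rightMul x η - adjoint (tmulRight _ (τ.toL2 1)) θ, evalL2 τ X P⟫_ℂ =
      ⟪tmulRight _ (τ.toL2 1) η, freeDiffL2 τ X i P⟫_ℂ)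
    (isClosed_eq (by fun_prop) (by fun_prop)) (fun Q => ?_) hη
  revert P
  change AdjointPair τ X i (htmul (evalL2 τ X Q) (τ.toL2 1)) _
  induction Q using freeAlgebra_induction_left with
  | one =>
    rw [evalL2_one, freeDiffL2_one, map_zero, sub_zero, TracialState.rightMul_toL2, one_mul]
    exact h
  | add P Q hP hQ => convert hP.add hQ using 1 <;> simp only [map_add, add_htmul]; abel
  | smul r P hP => convert hP.smul r using 1 <;> simp only [map_smul, smul_htmul, smul_sub]
  | ι_mul k P hP =>
    have h₂ := hP.leftMul hsa k
    rw [htensorMap_htmul, ← evalL2_ι_mul, coe_id', id_eq] at h₂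
    convert h₂ using 1
    have h₃ : ∀ θ : τ.L2L2, adjoint (tmulRight _ (τ.toL2 1))
        (htensorMap (τ.leftMul (X k)) (.id ℂ _) θ) =
          τ.leftMul (X k) (adjoint (tmulRight _ (τ.toL2 1)) θ) := by
      intro θ
      have : adjoint (tmulRight τ.L2 (τ.toL2 1)) ∘L htensorMap (τ.leftMul (X k)) (.id ℂ _) =
          τ.leftMul (X k) ∘L adjoint (tmulRight _ (τ.toL2 1)) :=
        ext_htmul fun a b => by
          simp [htensorMap_htmul, tmulRight_adjoint_htmul]
      exact congrArg (fun T => T θ) this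
    -- When k = i, both the adjoint and the slice of ∂ᵢ(XₖP) produce the term τ(P)1, and these
    -- agree.
    rw [freeDiffL2_ι_mul, evalL2_ι_mul, map_add, map_sub, h₃, TracialState.leftMul_rightMul]
    split_ifs
    · rw [tmulRight_adjoint_htmul, tmulLeft_adjoint_htmul]
      abel
    · simp

/-- Coassociativity yields `∂ᵢ*(1 ⊗ ξ) = ∂ᵢ*(ξ ⊗ 1)` for the conjugate variable `ξ = ∂ᵢ*(1 ⊗ 1)`. -/
theorem one_htmul {ξ : τ.L2} (h : AdjointPair τ X i τ.oneOne ξ)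
    (h' : AdjointPair τ X i (htmul ξ (τ.toL2 1)) w) :
    AdjointPair τ X i (htmul (τ.toL2 1) ξ) w := by
  intro P
  rw [h' P, freeDiffL2_apply]
  -- ε is τ of the evaluation and μ is ε ⊗ ε. Pairing with ξ is μ ∘ ∂ᵢ, so both pairings with ∂ᵢP
  -- are ε ⊗ ε ⊗ ε applied to an iterated difference quotient.
  let ε : FreeAlgebra ℂ (Fin n) →ₗ[ℂ] ℂ := (innerSL ℂ (τ.toL2 1)).toLinearMap ∘ₗ evalL2 τ X
  let μ : FreeAlgebra ℂ (Fin n) ⊗[ℂ] FreeAlgebra ℂ (Fin n) →ₗ[ℂ] ℂ :=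
    (innerSL ℂ τ.oneOne).toLinearMap ∘ₗ evalTensor τ X
  have hμ : ∀ p q, μ (p ⊗ₜ q) = ε p * ε q := fun p q => inner_htmul _ _ _ _
  have hξ : ∀ p, ⟪ξ, evalL2 τ X p⟫_ℂ = μ (freeDiff i p) := h
  have h₁ : ∀ t, ⟪htmul (τ.toL2 1) ξ, evalTensor τ X t⟫_ℂ =
      LinearMap.mul' ℂ ℂ (TensorProduct.map ε μ ((freeDiff i).lTensor _ t)) := by
    intro t
    induction t using TensorProduct.induction_on with
    | zero => simp
    | tmul p q =>
      rw [evalTensor_tmul, inner_htmul, hξ]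
      rfl
    | add a b ha hb => simp only [map_add, inner_add_right, ha, hb]
  have h₂ : ∀ t, ⟪htmul ξ (τ.toL2 1), evalTensor τ X t⟫_ℂ =
      LinearMap.mul' ℂ ℂ (TensorProduct.map ε μ
        (TensorProduct.assoc ℂ _ _ _ ((freeDiff i).rTensor _ t))) := by
    intro t
    induction t using TensorProduct.induction_on with
    | zero => simp
    | tmul p q =>
      rw [evalTensor_tmul, inner_htmul, hξ, LinearMap.rTensor_tmul]
      generalize freeDiff i p = s
      induction s using TensorProduct.induction_on with
      | zero => simp
      | tmul a b =>
        simp only [TensorProduct.assoc_tmul, TensorProduct.map_tmul, LinearMap.mul'_apply, hμ]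
        rw [mul_assoc]
        rfl
      | add a b ha hb => simp only [map_add, TensorProduct.add_tmul, add_mul, ha, hb]
    | add a b ha hb => simp only [map_add, inner_add_right, ha, hb]
  rw [h₁, h₂, freeDiff_coassoc]

end AdjointPair

end L2

end FreeProb

namespace FreeProb

open ContinuousLinearMap

/-! ### Lipschitz conjugate variables -/

section Main

variable {H : Type*} [NormedAddCommGroup H] [InnerProductSpace ℂ H] [CompleteSpace H]
  {M : VonNeumannAlgebra H} {τ : TracialState M} {n : ℕ} {X : Fin n → M.toStarSubalgebra}

namespace TracialState

theorem leftMul_one : τ.leftMul 1 = .id ℂ _ := τ.ext_toL2 fun x => by simp [leftMul_toL2]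

theorem rightMul_one : τ.rightMul 1 = .id ℂ _ := τ.ext_toL2 fun x => by simp [rightMul_toL2]

/-- The operators `R_b ⊗ L_c` are in the commutant of the von Neumann tensor product of `M` and
`Mᵒᵖ`. -/
theorem tensorOp_comm {T : τ.L2L2 →L[ℂ] τ.L2L2} (hT : T ∈ τ.tensorOp) (b c : M.toStarSubalgebra)
    (z : τ.L2L2) : T (htensorMap (τ.rightMul b) (τ.leftMul c) z) =
      htensorMap (τ.rightMul b) (τ.leftMul c) (T z) := by
  have key : ∀ a d, htensorMap (τ.leftMul a) (τ.rightMul d) *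
      htensorMap (τ.rightMul b) (τ.leftMul c) = htensorMap (τ.rightMul b) (τ.leftMul c) *
        htensorMap (τ.leftMul a) (τ.rightMul d) := fun a d => ext_htmul fun x y => by
    simp only [mul_apply_eq_comp, htensorMap_htmul, leftMul_rightMul]
  have hmem : htensorMap (τ.rightMul b) (τ.leftMul c) ∈ StarSubalgebra.centralizer ℂ
      {T | ∃ a b, T = htensorMap (τ.leftMul a) (τ.rightMul b)} := by
    rintro S (⟨a, d, rfl⟩ | ⟨a, d, h⟩)
    · exact key a d
    · have : S = htensorMap (τ.leftMul (star a)) (τ.rightMul (star d)) := by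
        rw [← star_star S, h, star_eq_adjoint, htensorMap_adjoint, leftMul_adjoint,
          rightMul_adjoint]
      rw [this]
      exact key _ _
  exact (congrArg (fun S => S z) (hT _ (Or.inl hmem))).symm

/-- The slice `(id ⊗ τ)(Z (1 ⊗ 1))` is bounded if `Z` commutes with the right multiplications on
the first leg. -/
theorem slice_mem_bounded {Z : τ.L2L2 →L[ℂ] τ.L2L2}
    (hZ : ∀ b z, Z (htensorMap (τ.rightMul b) (.id ℂ _) z) =
      htensorMap (τ.rightMul b) (.id ℂ _) (Z z)) :
    adjoint (tmulRight _ (τ.toL2 1)) (Z τ.oneOne) ∈ τ.bounded := by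
  -- The slice is S1 for S = (id ⊗ τ) Z (· ⊗ 1), a bounded operator inheriting commutation with
  -- right multiplications.
  refine τ.apply_one_mem_bounded
    (S := adjoint (tmulRight _ (τ.toL2 1)) ∘L Z ∘L tmulRight _ (τ.toL2 1)) fun b x => ?_
  have h₁ : ∀ x, tmulRight _ (τ.toL2 1) (τ.rightMul b x) =
      htensorMap (τ.rightMul b) (.id ℂ _) (tmulRight _ (τ.toL2 1) x) := fun x => by
    simp [htensorMap_htmul]
  have h₂ : adjoint (tmulRight τ.L2 (τ.toL2 1)) ∘L htensorMap (τ.rightMul b) (.id ℂ _) =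
      τ.rightMul b ∘L adjoint (tmulRight τ.L2 (τ.toL2 1)) := ext_htmul fun x y => by
    simp [htensorMap_htmul, tmulRight_adjoint_htmul]
  simp only [comp_apply]
  rw [h₁, hZ]
  exact congrArg (fun S => S (Z (tmulRight _ (τ.toL2 1) x))) h₂

theorem tensorOp_comm_id {T : τ.L2L2 →L[ℂ] τ.L2L2} (hT : T ∈ τ.tensorOp)
    (b : M.toStarSubalgebra) (z : τ.L2L2) : T (htensorMap (τ.rightMul b) (.id ℂ _) z) =
      htensorMap (τ.rightMul b) (.id ℂ _) (T z) := by
  simpa only [leftMul_one] using tensorOp_comm hT b 1 z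

theorem tensorOp_id_comm {T : τ.L2L2 →L[ℂ] τ.L2L2} (hT : T ∈ τ.tensorOp)
    (c : M.toStarSubalgebra) (z : τ.L2L2) : T (htensorMap (.id ℂ _) (τ.leftMul c) z) =
      htensorMap (.id ℂ _) (τ.leftMul c) (T z) := by
  simpa only [rightMul_one] using tensorOp_comm hT 1 c z

end TracialState

/-! ### Voiculescu's identity and boundedness -/

variable (τ) in
/-- The operator `a ⊗ b ↦ a x ⊗ b - a ⊗ x b`. -/
noncomputable def innerCommutator (x : M.toStarSubalgebra) : τ.L2L2 →L[ℂ] τ.L2L2 :=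
  htensorMap (τ.rightMul x) (.id ℂ _) - htensorMap (.id ℂ _) (τ.leftMul x)

theorem innerCommutator_htmul (x : M.toStarSubalgebra) (a b : τ.L2) :
    innerCommutator τ x (htmul a b) = htmul (τ.rightMul x a) b - htmul a (τ.leftMul x b) := by
  simp [innerCommutator, htensorMap_htmul]

theorem innerCommutator_leftMul (x y : M.toStarSubalgebra) (z : τ.L2L2) :
    innerCommutator τ x (htensorMap (τ.leftMul y) (.id ℂ _) z) =
      htensorMap (τ.leftMul y) (.id ℂ _) (innerCommutator τ x z) := by
  have : innerCommutator τ x ∘L htensorMap (τ.leftMul y) (.id ℂ _) =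
      htensorMap (τ.leftMul y) (.id ℂ _) ∘L innerCommutator τ x := ext_htmul fun a b => by
    simp [htensorMap_htmul, innerCommutator_htmul, TracialState.leftMul_rightMul]
  exact congrArg (fun S => S z) this

theorem innerCommutator_adjoint {x : M.toStarSubalgebra} (hx : IsSelfAdjoint x) :
    adjoint (innerCommutator τ x) = innerCommutator τ x := by
  rw [innerCommutator, map_sub, htensorMap_adjoint, htensorMap_adjoint,
    TracialState.leftMul_adjoint, TracialState.rightMul_adjoint, hx.star_eq,
    ContinuousLinearMap.adjoint_id]

/-- Voiculescu's identity `P ⊗ 1 - 1 ⊗ P = ∑ⱼ ∂ⱼ P # (Xⱼ ⊗ 1 - 1 ⊗ Xⱼ)`. -/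
theorem htmul_one_sub_one_htmul_evalL2 (P : FreeAlgebra ℂ (Fin n)) :
    htmul (evalL2 τ X P) (τ.toL2 1) - htmul (τ.toL2 1) (evalL2 τ X P) =
      ∑ j, innerCommutator τ (X j) (freeDiffL2 τ X j P) := by
  induction P using freeAlgebra_induction_left with
  | one => simp [evalL2_one, freeDiffL2_one]
  | add P Q hP hQ =>
    simp only [map_add, Finset.sum_add_distrib, ← hP, ← hQ, add_htmul, htmul_add]
    abel
  | smul r P hP =>
    simp only [map_smul, ← Finset.smul_sum, ← hP, smul_htmul, htmul_smul, smul_sub]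
  | ι_mul k P hP =>
    have h : ∀ j, innerCommutator τ (X j) (freeDiffL2 τ X j (FreeAlgebra.ι ℂ k * P)) =
        htensorMap (τ.leftMul (X k)) (.id ℂ _) (innerCommutator τ (X j) (freeDiffL2 τ X j P)) +
          if k = j then innerCommutator τ (X k) (htmul (τ.toL2 1) (evalL2 τ X P)) else 0 := by
      intro j
      rw [freeDiffL2_ι_mul, map_add, innerCommutator_leftMul]
      split_ifs with hj
      · rw [hj]
      · rw [map_zero]
    simp only [h]
    rw [Finset.sum_add_distrib, ← map_sum, ← hP, Finset.sum_ite_eq, if_pos (Finset.mem_univ _),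
      innerCommutator_htmul, map_sub, htensorMap_htmul, htensorMap_htmul, evalL2_ι_mul,
      TracialState.leftMul_toL2, TracialState.rightMul_toL2, mul_one, one_mul]
    simp

/-- Voiculescu's identity extends to the intersection of the domains of the closures of the `∂ⱼ`,
provided that the `∂ⱼ*` are defined on tensors of polynomials. -/
theorem htmul_one_sub_one_htmul (hsa : ∀ i, IsSelfAdjoint (X i)) (hd : DenseRange (evalL2 τ X))
    (hadj : ∀ j P Q, ∃ w, AdjointPair τ X j (htmul (evalL2 τ X P) (evalL2 τ X Q)) w)
    {η : τ.L2} {θ : Fin n → τ.L2L2} (hη : ∀ j, (η, θ j) ∈ (diffGraph τ X j).topologicalClosure) :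
    htmul η (τ.toL2 1) - htmul (τ.toL2 1) η = ∑ j, innerCommutator τ (X j) (θ j) := by
  refine ext_inner_htmul_of_denseRange hd hd fun a b => ?_
  -- The sequences approximating η in the different graphs need not coincide. Paired with a
  -- polynomial tensor, however, each summand equals ⟪wⱼ, η⟫, which is continuous in η alone, so
  -- density of the polynomials suffices.
  have h : ∀ j, ∃ w, AdjointPair τ X j
      (innerCommutator τ (X j) (htmul (evalL2 τ X a) (evalL2 τ X b))) w := fun j => by
    obtain ⟨w, hw⟩ := hadj j (a * FreeAlgebra.ι ℂ j) b
    obtain ⟨w', hw'⟩ := hadj j a (FreeAlgebra.ι ℂ j * b)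
    refine ⟨w - w', ?_⟩
    rw [innerCommutator_htmul, ← evalL2_mul_ι, ← evalL2_ι_mul]
    exact hw.sub hw'
  choose w hw using h
  have h₁ : ∀ j, ⟪htmul (evalL2 τ X a) (evalL2 τ X b), innerCommutator τ (X j) (θ j)⟫_ℂ =
      ⟪w j, η⟫_ℂ := fun j => by
    rw [← adjoint_inner_left, innerCommutator_adjoint (hsa j), ← (hw j).inner_eq (hη j)]
  rw [inner_sum, Finset.sum_congr rfl fun j _ => h₁ j]
  refine hd.induction_on (p := fun η => ⟪htmul (evalL2 τ X a) (evalL2 τ X b),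
    tmulRight _ (τ.toL2 1) η - tmulLeft _ (τ.toL2 1) η⟫_ℂ = ∑ j, ⟪w j, η⟫_ℂ) η
    (isClosed_eq (by fun_prop) (by fun_prop)) fun P => ?_
  rw [tmulRight_apply, tmulLeft_apply, htmul_one_sub_one_htmul_evalL2, inner_sum]
  refine Finset.sum_congr rfl fun j _ => ?_
  rw [hw j P, ← adjoint_inner_left, innerCommutator_adjoint (hsa j)]

/-- A vector with `∂ⱼ η ∈ M ⊗ Mᵒᵖ` for all `j` is in `M`. -/
theorem mem_bounded_of_lipschitz (hsa : ∀ i, IsSelfAdjoint (X i)) (hd : DenseRange (evalL2 τ X))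
    (hadj : ∀ j P Q, ∃ w, AdjointPair τ X j (htmul (evalL2 τ X P) (evalL2 τ X Q)) w)
    {η : τ.L2} (hη : ∀ j, ∃ θ ∈ τ.boundedTensor, (η, θ) ∈ (diffGraph τ X j).topologicalClosure) :
    η ∈ τ.bounded := by
  choose θ hθ hηθ using hη
  choose T hT hTθ using hθ
  have h₁ := htmul_one_sub_one_htmul hsa hd hadj hηθ
  -- The inner commutator commutes with T_j and can be moved onto 1 ⊗ 1. There it agrees with the
  -- outer commutator used in Z, which, unlike the inner one, commutes with right multiplications on
  -- the first leg.
  let Z : τ.L2L2 →L[ℂ] τ.L2L2 := ∑ j, T j ∘L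
    (htensorMap (τ.leftMul (X j)) (.id ℂ _) - htensorMap (.id ℂ _) (τ.rightMul (X j)))
  have hZ : Z τ.oneOne = htmul η (τ.toL2 1) - htmul (τ.toL2 1) η := by
    rw [h₁, _root_.sum_apply]
    refine Finset.sum_congr rfl fun j _ => ?_
    have h₂ : innerCommutator τ (X j) (T j τ.oneOne) = T j (innerCommutator τ (X j) τ.oneOne) := by
      simp only [innerCommutator, _root_.sub_apply, map_sub]
      rw [TracialState.tensorOp_comm_id (hT j), TracialState.tensorOp_id_comm (hT j)]
    rw [hTθ j, h₂, TracialState.oneOne, innerCommutator_htmul]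
    simp [htensorMap_htmul, TracialState.leftMul_toL2, TracialState.rightMul_toL2]
  have hb := TracialState.slice_mem_bounded (Z := Z) fun b z => by
    simp only [Z, _root_.sum_apply, map_sum, comp_apply]
    refine Finset.sum_congr rfl fun j _ => ?_
    rw [← TracialState.tensorOp_comm_id (hT j)]
    congr 1
    have : (htensorMap (τ.leftMul (X j)) (.id ℂ _) - htensorMap (.id ℂ _) (τ.rightMul (X j))) ∘L
        htensorMap (τ.rightMul b) (.id ℂ _) = htensorMap (τ.rightMul b) (.id ℂ _) ∘L
          (htensorMap (τ.leftMul (X j)) (.id ℂ _) - htensorMap (.id ℂ _) (τ.rightMul (X j))) :=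
      ext_htmul fun x y => by simp [htensorMap_htmul, TracialState.leftMul_rightMul]
    exact congrArg (fun S => S z) this
  -- Slicing η ⊗ 1 - 1 ⊗ η yields η - ⟪1, η⟫1, so η differs from an element of M by a scalar.
  rw [hZ, map_sub, tmulRight_adjoint_htmul, tmulRight_adjoint_htmul, TracialState.inner_toL2,
    star_one, mul_one, τ.map_one, one_smul] at hb
  obtain ⟨y, hy⟩ := hb
  refine ⟨y + ⟪τ.toL2 1, η⟫_ℂ • 1, ?_⟩
  rw [map_add, hy, map_smul, sub_add_cancel]

/-! ### Passage between adjoint pairs and unbounded operators -/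

variable (hX : AlgebraicallyFree X)

theorem partialDiff_graph (i : Fin n) : (partialDiff τ hX i).graph = diffGraph τ X i := by
  ext ⟨x, y⟩
  rw [LinearPMap.mem_graph_iff]
  constructor
  · rintro ⟨⟨_, P, rfl⟩, rfl, rfl⟩
    exact ⟨P, Prod.ext rfl (pmapOfInjective_apply _ _ _ P).symm⟩
  · rintro ⟨P, h⟩
    obtain ⟨rfl, rfl⟩ := Prod.ext_iff.1 h
    exact ⟨⟨_, P, rfl⟩, rfl, pmapOfInjective_apply _ _ _ P⟩

theorem mem_closure_diffGraph {i : Fin n} (hc : (partialDiff τ hX i).IsClosable) {η : τ.L2}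
    (hη : η ∈ (partialDiff τ hX i).closure.domain) :
    (η, (partialDiff τ hX i).closure ⟨η, hη⟩) ∈ (diffGraph τ X i).topologicalClosure := by
  rw [← partialDiff_graph hX, hc.graph_closure_eq_closure_graph]
  exact LinearPMap.mem_graph _ ⟨η, hη⟩

theorem AdjointPair.of_adjoint (hd : DenseRange (evalL2 τ X)) {i : Fin n} {ζ : τ.L2L2}
    (h : ζ ∈ (partialDiff τ hX i).adjoint.domain) :
    AdjointPair τ X i ζ ((partialDiff τ hX i).adjoint ⟨ζ, h⟩) := fun P => by
  have := LinearPMap.adjoint_isFormalAdjoint (T := partialDiff τ hX i) hd ⟨ζ, h⟩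
    ⟨evalL2 τ X P, LinearMap.mem_range_self _ P⟩
  exact this.trans (congrArg _ (pmapOfInjective_apply _ _ _ P))

theorem AdjointPair.exists_adjoint (hd : DenseRange (evalL2 τ X)) {i : Fin n} {ζ : τ.L2L2}
    {w : τ.L2} (h : AdjointPair τ X i ζ w) :
    ∃ hζ : ζ ∈ (partialDiff τ hX i).adjoint.domain, (partialDiff τ hX i).adjoint ⟨ζ, hζ⟩ = w := by
  have key : ∀ x : (partialDiff τ hX i).domain, ⟪w, (x : τ.L2)⟫_ℂ = ⟪ζ, partialDiff τ hX i x⟫_ℂ := by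
    rintro ⟨_, P, rfl⟩
    exact (h P).trans (congrArg _ (pmapOfInjective_apply _ _ _ P)).symm
  exact ⟨LinearPMap.mem_adjoint_domain_of_exists _ ⟨w, key⟩,
    LinearPMap.adjoint_apply_eq (T := partialDiff τ hX i) hd _ key⟩

/-- The adjoint of a composite is formed one factor at a time: ζ ⊗ c goes to w ⊗ c under ∂ᵢ* ⊗ id,
and then to u under ∂ⱼ*. -/
theorem AdjointPair.inner_freeDiff₂L2 {i j : Fin n} {ζ : τ.L2L2} {w : τ.L2} {c : τ.L2} {u : τ.L2}
    (h : AdjointPair τ X i ζ w) (h' : AdjointPair τ X j (htmul w c) u)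
    (P : FreeAlgebra ℂ (Fin n)) :
    ⟪u, evalL2 τ X P⟫_ℂ = ⟪htmul ζ c, freeDiff₂L2 τ X i j P⟫_ℂ := by
  have key : ∀ t, ⟪htmul w c, evalTensor τ X t⟫_ℂ = ⟪htmul ζ c, toHilbertTensor τ.L2L2 τ.L2
      (TensorProduct.map (freeDiffL2 τ X i) (evalL2 τ X) t)⟫_ℂ := by
    intro t
    induction t using TensorProduct.induction_on with
    | zero => simp
    | tmul p q =>
      rw [evalTensor_tmul, inner_htmul, h p, ← inner_htmul]
      rfl
    | add a b ha hb => simp only [map_add, inner_add_right, ha, hb]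
  rw [h' P]
  exact key _

/-- A densely defined formal adjoint makes an operator closable. -/
theorem isClosable_pmapOfInjective {A E F : Type*} [AddCommGroup A] [Module ℂ A]
    [NormedAddCommGroup E] [InnerProductSpace ℂ E] [NormedAddCommGroup F] [InnerProductSpace ℂ F]
    (f : A →ₗ[ℂ] E) (hf : Function.Injective f) (g : A →ₗ[ℂ] F) (D : Set F)
    (hD : ∀ y, (∀ ω ∈ D, ⟪ω, y⟫_ℂ = 0) → y = 0)
    (hg : ∀ ω ∈ D, ∃ u, ∀ P, ⟪u, f P⟫_ℂ = ⟪ω, g P⟫_ℂ) : (pmapOfInjective f hf g).IsClosable := by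
  refine ⟨(pmapOfInjective f hf g).graph.topologicalClosure.toLinearPMap, ?_⟩
  rw [Submodule.toLinearPMap_graph_eq]
  rintro ⟨x, y⟩ hxy (rfl : x = 0)
  refine hD y fun ω hω => ?_
  obtain ⟨u, hu⟩ := hg ω hω
  -- The formal adjoint relation is a closed condition on pairs, so it holds on the closed graph. At
  -- (0, y) it says that y is orthogonal to the total set D.
  have hcl : IsClosed {z : E × F | ⟪u, z.1⟫_ℂ = ⟪ω, z.2⟫_ℂ} :=
    isClosed_eq (by fun_prop) (by fun_prop)
  have hsub : ((pmapOfInjective f hf g).graph : Set (E × F)) ⊆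
      {z : E × F | ⟪u, z.1⟫_ℂ = ⟪ω, z.2⟫_ℂ} := by
    rintro ⟨x, y⟩ h
    obtain ⟨⟨_, P, rfl⟩, rfl, rfl⟩ := (LinearPMap.mem_graph_iff _).1 h
    exact (hu P).trans (congrArg _ (pmapOfInjective_apply _ _ _ P)).symm
  have : ⟪u, (0 : E)⟫_ℂ = ⟪ω, y⟫_ℂ := closure_minimal hsub hcl hxy
  rw [← this, inner_zero_right]

end Main

end FreeProb

/-! ### The proposition -/

theorem mainTheorem7 {H : Type*} [NormedAddCommGroup H] [InnerProductSpace ℂ H] [CompleteSpace H]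
    {M : VonNeumannAlgebra H} (τ : FreeProb.TracialState M) {n : ℕ}
    (X : Fin n → M.toStarSubalgebra) (hsa : ∀ i, IsSelfAdjoint (X i))
    (hgen : M = FreeProb.vonNeumannGenerated (Set.range fun i => (X i : H →L[ℂ] H)))
    (hX : FreeProb.AlgebraicallyFree X)
    (hLip : FreeProb.LipschitzConjugateVariables τ hX) :
    let ξ : Fin n → τ.L2 := fun i =>
      FreeProb.conjugateVariable τ hX i (hLip.exists_conjugate i)
    (∀ i, ξ i ∈ τ.bounded) ∧
    (∀ i, ∃ (h₁ : FreeProb.htmul (τ.toL2 1) (ξ i) ∈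
          (FreeProb.partialDiff τ hX i).adjoint.domain)
        (h₂ : FreeProb.htmul (ξ i) (τ.toL2 1) ∈
          (FreeProb.partialDiff τ hX i).adjoint.domain),
      (FreeProb.partialDiff τ hX i).adjoint ⟨_, h₁⟩ =
          (FreeProb.partialDiff τ hX i).adjoint ⟨_, h₂⟩ ∧
        (FreeProb.partialDiff τ hX i).adjoint ⟨_, h₁⟩ ∈ τ.bounded) ∧
    (∀ i j, Dense ((FreeProb.partialDiff₂ τ hX i j).domain : Set τ.L2) ∧
      (FreeProb.partialDiff₂ τ hX i j).IsClosable) := by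
  intro ξ
  have hd := FreeProb.denseRange_evalL2 τ X hsa hgen
  have hξ : ∀ i, FreeProb.AdjointPair τ X i τ.oneOne (ξ i) := fun i =>
    .of_adjoint hX hd (hLip.exists_conjugate i)
  have hgraph : ∀ i j, ∃ θ ∈ τ.boundedTensor,
      (ξ i, θ) ∈ (FreeProb.diffGraph τ X j).topologicalClosure := fun i j => by
    obtain ⟨h, hb⟩ := hLip.lipschitz i j
    exact ⟨_, hb, FreeProb.mem_closure_diffGraph hX (hLip.closable j) h⟩
  have hdom : ∀ i j, ξ i ∈ FreeProb.closureDomain τ X j := fun i j => by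
    obtain ⟨θ, -, hθ⟩ := hgraph i j
    exact FreeProb.mem_closureDomain.2 ⟨θ, hθ⟩
  have hbdd : ∀ i, ξ i ∈ τ.bounded := fun i =>
    FreeProb.mem_bounded_of_lipschitz hsa hd (fun j P Q => by
      obtain ⟨w, -, hw⟩ := (hξ j).exists_of_poly hsa (hdom j j) P Q
      exact ⟨w, hw⟩) (hgraph i)
  refine ⟨hbdd, fun i => ?_, fun i j => ⟨hd, ?_⟩⟩
  · obtain ⟨θ, ⟨T, hT, rfl⟩, hθ⟩ := hgraph i i
    obtain ⟨x, hx⟩ := hbdd i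
    have h₂ := FreeProb.AdjointPair.htmul_one hsa (hx ▸ hξ i) hθ
    have h₁ := (hξ i).one_htmul h₂
    obtain ⟨hm₁, he₁⟩ := h₁.exists_adjoint hX hd
    obtain ⟨hm₂, he₂⟩ := h₂.exists_adjoint hX hd
    refine ⟨hm₁, hm₂, he₁.trans he₂.symm, he₁ ▸ ?_⟩
    obtain ⟨y, hy⟩ := FreeProb.TracialState.slice_mem_bounded
      (FreeProb.TracialState.tensorOp_comm_id hT)
    -- The second-order conjugate variable is ξᵢ² - (id ⊗ τ)(∂ᵢξᵢ), with y the bounded slice.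
    exact ⟨x * x - y, by rw [map_sub, hy, ← hx, FreeProb.TracialState.rightMul_toL2]⟩
  · obtain ⟨x, hx⟩ := hbdd j
    refine FreeProb.isClosable_pmapOfInjective _ _ _
      {ω | ∃ P Q R, ω = FreeProb.htmul (FreeProb.htmul (FreeProb.evalL2 τ X P)
        (FreeProb.evalL2 τ X Q)) (FreeProb.evalL2 τ X R)} (fun y hy => ?_) ?_
    · refine FreeProb.ext_inner_htmul_of_denseRange Function.surjective_id.denseRange hd
        fun u R => ?_
      have : ContinuousLinearMap.adjoint (FreeProb.tmulRight _ (FreeProb.evalL2 τ X R)) y = 0 :=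
        FreeProb.ext_inner_htmul_of_denseRange hd hd fun P Q => by
          rw [ContinuousLinearMap.adjoint_inner_right, inner_zero_right]
          exact hy _ ⟨P, Q, R, rfl⟩
      rw [inner_zero_right, id, ← FreeProb.tmulRight_apply,
        ← ContinuousLinearMap.adjoint_inner_right, this, inner_zero_right]
    · rintro _ ⟨P, Q, R, rfl⟩
      -- The mixed Lipschitz condition, ξᵢ in the domain of the closure of ∂ⱼ, enters here: it lets
      -- ∂ⱼ* be applied to w ⊗ 1 for w = ∂ᵢ*(P ⊗ Q).
      obtain ⟨w, hw, hadj⟩ := (hξ i).exists_of_poly hsa (hdom i j) P Q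
      obtain ⟨θ, hθ⟩ := FreeProb.mem_closureDomain.1 hw
      obtain ⟨u, hu⟩ := (FreeProb.AdjointPair.htmul_one hsa (hx ▸ hξ j) hθ).exists_htmul_poly hsa R
      exact ⟨u, hadj.inner_freeDiff₂L2 hu⟩
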